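/- Let $1<p<\infty$ with $p\neq 2$, let $J$ be any set, and let $\ell^p(J)$ be the complex Banach space of functions $f\colon J\to\mathbb C$ with $\|f\|=\bigl(\sum_{j\in J}|f(j)|^p\bigr)^{1/p}<\infty$. Let $\mathcal A$ be a (not necessarily unital) complex $C^*$-algebra and let $\phi\colon\mathcal A\to B(\ell^p(J))$ be a homomorphism, i.e. a bounded linear multiplicative map into the algebra of bounded linear operators on $\ell^p(J)$ (if $\mathcal A$ has a unit, $\phi$ need not preserve it). Then: (i) for every $x\in \ell^p(J)$, the norm closure of $\{\phi(a)x : a\in\mathcal A,\ \|a\|\le 1\}$ in $\ell^p(J)$ is norm compact; (ii) the quotient $\mathcal A/\ker\phi$, with the operations and the involution induced from $\mathcal A$ and the quotient norm, is a residually finite dimensional $C^*$-algebra. Here a $C^*$-algebra $\mathcal B$ is residually finite dimensional if for every nonzero $b\in\mathcal B$ there is a $*$-representation $\rho$ of $\mathcal B$ on a finite dimensional Hilbert space with $\rho(b)\neq 0$. -/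

import Mathlib

/-- A (not necessarily unital) C⋆-algebra is residually finite dimensional if its nonzero elements
are detected by ⋆-representations on finite dimensional Hilbert spaces. (Every finite dimensional
complex Hilbert space is unitarily equivalent to some `EuclideanSpace ℂ (Fin n)`; the
representations are not required to be unital or nondegenerate.) -/
def IsResiduallyFiniteDimensional (A : Type*) [NonUnitalCStarAlgebra A] : Prop :=
  ∀ a : A, a ≠ 0 →
    ∃ (n : ℕ) (ρ : A →⋆ₙₐ[ℂ] (EuclideanSpace ℂ (Fin n) →L[ℂ] EuclideanSpace ℂ (Fin n))),
      ρ a ≠ 0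

section KernelQuotient

variable {A B : Type*} [NonUnitalRing A] [Module ℂ A] [NonUnitalRing B] [Module ℂ B]

/-- The set `A / ker φ` of cosets of the kernel of an algebra homomorphism `φ`. It is a type synonym
on which no operations are declared, so that the only structure ever considered on it is the one
that is explicitly given. -/
def KernelQuotient (φ : A →ₙₐ[ℂ] B) : Type _ :=
  A ⧸ LinearMap.ker (φ : A →ₗ[ℂ] B)

/-- The quotient map `A → A / ker φ`. -/
def KernelQuotient.mk (φ : A →ₙₐ[ℂ] B) (a : A) : KernelQuotient φ :=
  Submodule.Quotient.mk (p := LinearMap.ker (φ : A →ₗ[ℂ] B)) a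

end KernelQuotient

/-- `S` is the quotient C⋆-algebra structure on `A / ker φ`: its operations (addition,
multiplication, scalar multiplication, involution) are those induced by the operations of `A` on
representatives, and its norm is the quotient norm. -/
structure IsQuotientCStarStructure {A B : Type*} [NonUnitalCStarAlgebra A] [NonUnitalRing B]
    [Module ℂ B] (φ : A →ₙₐ[ℂ] B) (S : NonUnitalCStarAlgebra (KernelQuotient φ)) : Prop where
  mk_add : ∀ a b : A,
    KernelQuotient.mk φ (a + b) = KernelQuotient.mk φ a + KernelQuotient.mk φ b
  mk_mul : ∀ a b : A,
    KernelQuotient.mk φ (a * b) = KernelQuotient.mk φ a * KernelQuotient.mk φ b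
  mk_smul : ∀ (c : ℂ) (a : A), KernelQuotient.mk φ (c • a) = c • KernelQuotient.mk φ a
  mk_star : ∀ a : A, KernelQuotient.mk φ (star a) = star (KernelQuotient.mk φ a)
  norm_mk : ∀ a : A, ‖KernelQuotient.mk φ a‖ = Metric.infDist a {b : A | φ b = 0}

/-! Everything rests on the compactness in (i) of the orbit maps `a ↦ φ a x`.

For `p < 2`, every bounded linear map `u` from a C⋆-algebra into `ℓᵖ` is compact. The engine is a
little Grothendieck inequality `∑ ‖u b‖² ≤ K ‖∑ b²‖` for self-adjoint `b`, where `K` depends only on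
a bound for `u` and a cotype 2 constant of the target (`sum_norm_sq_le_of_cotype`). Applied to all
sums `± b₁ ± ⋯ ± bₙ` and combined with Khintchine, it bounds the `p`-th power of the norm of the
square function of `n` contractions by a multiple of `n ^ (p / 2)`. If the images of contractions
did not have uniformly small tails, `n` of them with mass on disjoint blocks would make this
quantity at least `n * ε`, which is impossible for large `n` (`exists_finset_forall_sum_le`).

For `p > 2` the multiplicativity of `φ` enters. The map `a ↦ y ∘ φ a` goes into the dual of `ℓᵖ`,
which embeds in `ℓ^q` with `q < 2`, so it is compact. Thus the unitary group of the unitization has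
totally bounded orbits on the dual, and uniform convexity of `ℓᵖ` carries this over to the orbits in
`ℓᵖ` (`totallyBounded_orbit_of_dual`). Unitaries suffice because four of them span any given
element.

For (ii), a matrix coefficient of `φ` yields a functional `G` whose unitary translates form a
totally bounded set. Kakutani's fixed point theorem averages the forms `|G (u ·)|²` to a positive
invariant form, and the unitary orbits in its GNS representation are again totally bounded. A second
averaging, now of rank-one operators, produces nonzero compact self-adjoint operators that commute
with the representation. Their eigenspaces are finite dimensional and invariant, and they detect
`G`. The resulting representations vanish on `ker φ` and separate the remaining elements, so `ker φ`
is their joint kernel. The quotient norm is then the supremum of the norms in these representations,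
which gives the C⋆-identity. -/

/-! ### Fixed points of groups of isometries on compact convex sets. -/

open Set Metric in
/-- A compact convex set with more than one point is contained in a ball centred at one of its
points with radius less than its diameter. -/
theorem Convex.exists_forall_dist_le_lt_diam {E : Type*} [NormedAddCommGroup E] [NormedSpace ℝ E]
    {K : Set E} (hK : IsCompact K) (hconv : Convex ℝ K) (hnt : K.Nontrivial) :
    ∃ z ∈ K, ∃ r < diam K, ∀ k ∈ K, dist z k ≤ r := by
  classical
  have hd : 0 < diam K := by
    obtain ⟨x, hx, y, hy, hxy⟩ := hnt
    exact (dist_pos.2 hxy).trans_le (dist_le_diam_of_mem hK.isBounded hx hy)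
  obtain ⟨t, htK, htf, hcov⟩ := finite_cover_balls_of_compact hK (half_pos hd)
  lift t to Finset E using htf
  have hne : t.Nonempty := by
    obtain ⟨x, hx⟩ := hnt.nonempty
    obtain ⟨y, hy, -⟩ := mem_iUnion₂.1 (hcov hx)
    exact ⟨y, hy⟩
  have hn : (0 : ℝ) < t.card := by exact_mod_cast hne.card_pos
  -- The centre is the barycentre of a net of mesh `diam K / 2`. Every `k` is within `diam K / 2` of
  -- one net point and within `diam K` of the others, so averaging gains `diam K / (2 * t.card)`.
  refine ⟨∑ y ∈ t, (t.card : ℝ)⁻¹ • y, ?_, diam K * (1 - (2 * (t.card : ℝ))⁻¹), ?_, ?_⟩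
  · exact hconv.sum_mem (fun _ _ => by positivity) (by simp [hn.ne']) fun y hy => htK hy
  · have : 0 < (2 * (t.card : ℝ))⁻¹ := by positivity
    nlinarith
  · intro k hk
    obtain ⟨y₀, hy₀, hky⟩ := mem_iUnion₂.1 (hcov hk)
    have hsub : (∑ y ∈ t, (t.card : ℝ)⁻¹ • y) - k = ∑ y ∈ t, (t.card : ℝ)⁻¹ • (y - k) := by
      simp_rw [smul_sub, Finset.sum_sub_distrib, Finset.sum_const, ← Nat.cast_smul_eq_nsmul ℝ,
        smul_smul, mul_inv_cancel₀ hn.ne', one_smul]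
    rw [dist_eq_norm, hsub]
    calc ‖∑ y ∈ t, (t.card : ℝ)⁻¹ • (y - k)‖
        ≤ ∑ y ∈ t, (t.card : ℝ)⁻¹ * ‖y - k‖ := by
          refine (norm_sum_le _ _).trans_eq (Finset.sum_congr rfl fun y _ => ?_)
          rw [norm_smul, norm_inv, Real.norm_natCast]
      _ = (t.card : ℝ)⁻¹ * (∑ y ∈ t.erase y₀, ‖y - k‖ + ‖y₀ - k‖) := by
          rw [Finset.sum_erase_add _ _ hy₀, Finset.mul_sum]
      _ ≤ (t.card : ℝ)⁻¹ * ((t.card - 1) * diam K + diam K / 2) := by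
          gcongr
          · calc ∑ y ∈ t.erase y₀, ‖y - k‖ ≤ ∑ y ∈ t.erase y₀, diam K := by
                  refine Finset.sum_le_sum fun y hy => ?_
                  rw [← dist_eq_norm]
                  exact dist_le_diam_of_mem hK.isBounded (htK (Finset.mem_of_mem_erase hy)) hk
              _ = (t.card - 1) * diam K := by
                  rw [Finset.sum_const, Finset.card_erase_of_mem hy₀, nsmul_eq_mul,
                    Nat.cast_sub hne.card_pos, Nat.cast_one]
          · rw [← dist_eq_norm, dist_comm]
            exact (mem_ball.1 hky).le
      _ = diam K * (1 - (2 * (t.card : ℝ))⁻¹) := by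
          field_simp
          ring

open Set Metric in
/-- **Kakutani's fixed point theorem** for a family of linear isometries, closed under inverses,
which preserves a compact convex set. -/
theorem IsCompact.exists_forall_fixed_of_isometry {E ι : Type*} [NormedAddCommGroup E]
    [NormedSpace ℝ E] {C : Set E} (hC : IsCompact C) (hconv : Convex ℝ C) (hne : C.Nonempty)
    (T : ι → E →ₗ[ℝ] E) (hnorm : ∀ i x, ‖T i x‖ = ‖x‖) (hinv : ∀ i, ∃ j, ∀ x, T i (T j x) = x)
    (hmaps : ∀ i, MapsTo (T i) C C) : ∃ x ∈ C, ∀ i, T i x = x := by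
  let P : Set (Set E) := {K | IsCompact K ∧ Convex ℝ K ∧ K.Nonempty ∧ ∀ i, MapsTo (T i) K K}
  obtain ⟨K, hKC, hKmin⟩ := zorn_superset_nonempty P (fun c hcP hc hcne => by
    have := hcne.to_subtype
    refine ⟨⋂₀ c, ⟨?_, ?_, ?_, ?_⟩, fun s hs => sInter_subset_of_mem hs⟩
    · obtain ⟨s, hs⟩ := hcne
      exact (hcP hs).1.of_isClosed_subset (isClosed_sInter fun s hs => (hcP hs).1.isClosed)
        (sInter_subset_of_mem hs)
    · exact convex_sInter fun s hs => (hcP hs).2.1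
    · rw [sInter_eq_iInter]
      refine IsCompact.nonempty_iInter_of_directed_nonempty_isCompact_isClosed _ ?_
        (fun s => (hcP s.2).2.2.1) (fun s => (hcP s.2).1) (fun s => (hcP s.2).1.isClosed)
      intro a b
      rcases hc.total a.2 b.2 with h | h
      exacts [⟨a, subset_rfl, h⟩, ⟨b, h, subset_rfl⟩]
    · intro i x hx s hs
      exact (hcP hs).2.2.2 i (hx s hs)) C ⟨hC, hconv, hne, hmaps⟩
  obtain ⟨hKc, hKconv, ⟨x, hx⟩, hKmaps⟩ := hKmin.prop
  refine ⟨x, hKC hx, fun i => ?_⟩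
  by_contra hne'
  obtain ⟨z, hz, r, hr, hzr⟩ :=
    hKconv.exists_forall_dist_le_lt_diam hKc ⟨T i x, hKmaps i hx, x, hx, hne'⟩
  have hdist : ∀ i x y, dist (T i x) (T i y) = dist x y := fun i x y => by
    rw [dist_eq_norm, dist_eq_norm, ← map_sub, hnorm]
  -- The points of `K` from which all of `K` is within `r < diam K` form a smaller invariant compact
  -- convex set. Minimality forces it to be all of `K`, so `diam K ≤ r`.
  let K' : Set E := {w ∈ K | ∀ k ∈ K, dist w k ≤ r}
  have hK'eq : K' = K ∩ ⋂ k ∈ K, closedBall k r := by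
    ext w
    simp [K', mem_closedBall]
  have hK' : K' ∈ P := by
    refine ⟨?_, ?_, ⟨z, hz, hzr⟩, ?_⟩
    · rw [hK'eq]
      exact hKc.inter_right (isClosed_biInter fun k _ => isClosed_closedBall)
    · rw [hK'eq]
      exact hKconv.inter (convex_iInter₂ fun k _ => convex_closedBall k r)
    · rintro i w ⟨hw, hwr⟩
      refine ⟨hKmaps i hw, fun k hk => ?_⟩
      obtain ⟨j, hj⟩ := hinv i
      -- Closure under inverses is needed here: `k` is the image under `T i` of a point of `K`.
      rw [← hj k, hdist]
      exact hwr _ (hKmaps j hk)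
  have hKK' : K ⊆ K' := hKmin.le_of_le hK' fun w hw => hw.1
  refine hr.not_ge (diam_le_of_forall_dist_le (dist_nonneg.trans (hzr z hz)) fun a ha b hb => ?_)
  exact (hKK' ha).2 b hb

/-- A totally bounded set in a Banach space preserved by a family of linear isometries closed under
inverses has a common fixed point in its closed convex hull. -/
theorem TotallyBounded.exists_fixed_mem_closure {E ι : Type*} [NormedAddCommGroup E]
    [NormedSpace ℝ E] [CompleteSpace E] {s : Set E} (hs : TotallyBounded s) (hne : s.Nonempty)
    (T : ι → E →ₗ[ℝ] E) (hnorm : ∀ i x, ‖T i x‖ = ‖x‖) (hinv : ∀ i, ∃ j, ∀ x, T i (T j x) = x)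
    (hmaps : ∀ i, Set.MapsTo (T i) s s) :
    ∃ x ∈ _root_.closure (_root_.convexHull ℝ s), ∀ i, T i x = x := by
  refine IsCompact.exists_forall_fixed_of_isometry ?_ (convex_convexHull ℝ s).closure ?_ T hnorm
    hinv fun i => ?_
  · exact isCompact_iff_totallyBounded_isComplete.2 ⟨hs.convexHull.closure, isClosed_closure.isComplete⟩
  · exact hne.convexHull.closure
  · have hcont : Continuous (T i) :=
      (LinearMap.mkContinuous (T i) 1 fun x => by simp [hnorm]).continuous
    refine Set.MapsTo.closure ?_ hcont
    rw [Set.mapsTo_iff_image_subset, (T i).image_convexHull]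
    exact convexHull_mono (hmaps i).image_subset

/-! ### Criteria for total boundedness of a range. -/

open Set in
theorem totallyBounded_range_iff {X ι : Type*} [PseudoMetricSpace X] {f : ι → X} :
    TotallyBounded (range f) ↔ ∀ ε > 0, ∃ t : Finset ι, ∀ i, ∃ j ∈ t, dist (f i) (f j) < ε := by
  classical
  refine ⟨fun h ε hε => ?_, fun h => Metric.totallyBounded_iff.2 fun ε hε => ?_⟩
  · obtain ⟨t, ht, htf, hcov⟩ := Metric.finite_approx_of_totallyBounded h ε hε
    obtain ⟨u, -, huf, rfl⟩ := (Set.exists_subset_image_finite_and (f := f) (s := univ)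
      (p := fun s => s = t)).1 ⟨t, by simpa using ht, htf, rfl⟩
    refine ⟨huf.toFinset, fun i => ?_⟩
    obtain ⟨y, ⟨j, hj, rfl⟩, hy⟩ := mem_iUnion₂.1 (hcov (mem_range_self i))
    exact ⟨j, huf.mem_toFinset.2 hj, hy⟩
  · obtain ⟨t, ht⟩ := h ε hε
    refine ⟨f '' t, t.finite_toSet.image f, ?_⟩
    rintro _ ⟨i, rfl⟩
    obtain ⟨j, hj, hij⟩ := ht i
    exact mem_iUnion₂.2 ⟨f j, mem_image_of_mem f hj, hij⟩

open Set in
/-- Total boundedness of a range can be tested by maps into other metric spaces. -/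
theorem totallyBounded_range_of_forall_exists {X ι : Type*} [PseudoMetricSpace X] {f : ι → X}
    (h : ∀ ε > 0, ∃ (n : ℕ) (g : ι → Fin n → ℂ) (δ : ℝ), 0 < δ ∧ Bornology.IsBounded (range g) ∧
      ∀ i j, dist (g i) (g j) < δ → dist (f i) (f j) < ε) :
    TotallyBounded (range f) := by
  refine totallyBounded_range_iff.2 fun ε hε => ?_
  obtain ⟨n, g, δ, hδ, hg, hfg⟩ := h ε hε
  obtain ⟨t, ht⟩ := totallyBounded_range_iff.1
    (hg.isCompact_closure.totallyBounded.subset subset_closure) δ hδ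
  refine ⟨t, fun i => ?_⟩
  obtain ⟨j, hj, hij⟩ := ht i
  exact ⟨j, hj, hfg i j hij⟩

/-! ### Hilbert space representations with totally bounded unitary orbits. -/

section HilbertSpaceRepresentation

open scoped InnerProductSpace ComplexOrder

variable {B H : Type*} [CStarAlgebra B] [NormedAddCommGroup H] [InnerProductSpace ℂ H]
  [CompleteSpace H]

theorem norm_rankOne_self_sub_le (x y : H) :
    ‖InnerProductSpace.rankOne ℂ x x - InnerProductSpace.rankOne ℂ y y‖ ≤
      (‖x‖ + ‖y‖) * ‖x - y‖ := by
  have h : InnerProductSpace.rankOne ℂ x x - InnerProductSpace.rankOne ℂ y y =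
      InnerProductSpace.rankOne ℂ x (x - y) + InnerProductSpace.rankOne ℂ (x - y) y := by
    simp
  rw [h]
  refine (norm_add_le _ _).trans ?_
  rw [InnerProductSpace.norm_rankOne, InnerProductSpace.norm_rankOne]
  linarith

theorem norm_unitary_rep_apply (π : B →⋆ₐ[ℂ] (H →L[ℂ] H)) (u : unitary B) (x : H) :
    ‖π u x‖ = ‖x‖ := by
  exact ContinuousLinearMap.norm_map_of_mem_unitary
    (Unitary.map_mem π u.2) x

/-- A nonzero vector whose orbit under the unitary group is totally bounded generates a closed
invariant subspace that contains a nonzero finite dimensional invariant subspace. -/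
theorem exists_finiteDimensional_invariant (π : B →⋆ₐ[ℂ] (H →L[ℂ] H)) (N : Submodule ℂ H)
    (hN : IsClosed (N : Set H)) (hinv : ∀ b, ∀ x ∈ N, π b x ∈ N) {ζ : H} (hζN : ζ ∈ N)
    (hζ : ζ ≠ 0) (htb : TotallyBounded (Set.range fun u : unitary B => π u ζ)) :
    ∃ W ≤ N, W ≠ ⊥ ∧ FiniteDimensional ℂ W ∧ ∀ b, ∀ w ∈ W, π b w ∈ W := by
  -- Conjugation by `π v` sends `P u` to `P (v * u)`, so a conjugation-invariant average of the `P
  -- u` commutes with the representation.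
  let P : unitary B → H →L[ℂ] H := fun u => InnerProductSpace.rankOne ℂ (π u ζ) (π u ζ)
  have hnorm : ∀ u : unitary B, ‖π u ζ‖ = ‖ζ‖ := fun u => norm_unitary_rep_apply π u ζ
  have hζ' : 0 < ‖ζ‖ := norm_pos_iff.2 hζ
  have hP : TotallyBounded (Set.range P) := by
    refine totallyBounded_range_iff.2 fun ε hε => ?_
    obtain ⟨t, ht⟩ := totallyBounded_range_iff.1 htb (ε / (2 * ‖ζ‖)) (by positivity)
    refine ⟨t, fun u => ?_⟩
    obtain ⟨v, hv, huv⟩ := ht u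
    refine ⟨v, hv, ?_⟩
    rw [dist_eq_norm] at huv ⊢
    refine (norm_rankOne_self_sub_le _ _).trans_lt ?_
    rw [hnorm, hnorm]
    rw [lt_div_iff₀ (by positivity)] at huv
    linarith
  let T : unitary B → (H →L[ℂ] H) →ₗ[ℝ] (H →L[ℂ] H) := fun v =>
    (LinearMap.mulLeft ℝ (π v)).comp (LinearMap.mulRight ℝ (π (star (v : B))))
  have hTapp : ∀ v X, T v X = π v * (X * π (star (v : B))) := fun v X => rfl
  have hTinv : ∀ v X, T v (T (star v) X) = X := by
    intro v X
    have h1 : π v * π (star (v : B)) = 1 := by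
      simp [← map_mul]
    rw [hTapp, hTapp, Unitary.coe_star, star_star]
    calc _ = (π v * π (star (v : B))) * X * (π v * π (star (v : B))) := by
          simp only [mul_assoc]
      _ = X := by rw [h1, one_mul, mul_one]
  have hTnorm : ∀ v X, ‖T v X‖ = ‖X‖ := by
    intro v X
    have h1 := CStarRing.norm_coe_unitary_mul ⟨π v, Unitary.map_mem π v.2⟩
      (X * π (star (v : B)))
    have h2 := CStarRing.norm_mul_coe_unitary X
      ⟨π (star (v : B)), Unitary.map_mem π (star v).2⟩
    exact h1.trans h2
  have hTP : ∀ v u, T v (P u) = P (v * u) := by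
    intro v u
    ext x
    simp [hTapp, P, map_star, ContinuousLinearMap.star_eq_adjoint,
      ContinuousLinearMap.adjoint_inner_right]
  obtain ⟨K, hK, hfix⟩ := hP.exists_fixed_mem_closure (Set.range_nonempty P) T hTnorm
    (fun v => ⟨star v, hTinv v⟩) (by rintro v _ ⟨u, rfl⟩; exact ⟨v * u, (hTP v u).symm⟩)
  -- Any closed convex condition satisfied by all `P u` passes to `K`. Compactness,
  -- self-adjointness, range in `N` and nonvanishing are all obtained in this way.
  have hmem : ∀ S : Set (H →L[ℂ] H), Convex ℝ S → IsClosed S → (∀ u, P u ∈ S) → K ∈ S :=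
    fun S hS hS' hPS => closure_minimal (convexHull_min (Set.range_subset_iff.2 hPS) hS) hS' hK
  have hKc : IsCompactOperator K := by
    refine hmem {X | IsCompactOperator X} ?_ isClosed_setOfPred_isCompactOperator fun u => ?_
    · intro X hX Y hY a b _ _ _
      exact (hX.smul a).add (hY.smul b)
    · exact (isCompactOperator_of_locallyCompactSpace_dom 
        (innerSL ℂ (π u ζ))).clm_comp (ContinuousLinearMap.toSpanSingleton ℂ (π u ζ))
  have hKs : IsSelfAdjoint K := by
    refine hmem {X | IsSelfAdjoint X} ?_ ?_ fun u => ?_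
    · intro X hX Y hY a b _ _ _
      exact ((IsSelfAdjoint.all a).smul hX).add ((IsSelfAdjoint.all b).smul hY)
    · exact isClosed_eq continuous_star continuous_id
    · refine ContinuousLinearMap.isSelfAdjoint_iff_isSymmetric.2 fun x y => ?_
      simp [P, inner_smul_left, inner_smul_right, mul_comm]
  have hKN : ∀ x, K x ∈ N := by
    refine hmem {X | ∀ x, X x ∈ N} ?_ ?_ fun u => ?_
    · intro X hX Y hY a b _ _ _ x
      exact N.add_mem (N.smul_of_tower_mem a (hX x)) (N.smul_of_tower_mem b (hY x))
    · rw [Set.ofPred_forall]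
      exact isClosed_iInter fun x => hN.preimage (by fun_prop)
    · intro x
      exact N.smul_mem _ (hinv _ _ hζN)
  have hK0 : K ≠ 0 := by
    obtain ⟨t, ht⟩ := totallyBounded_range_iff.1 htb (‖ζ‖ / 2) (by positivity)
    -- An average could vanish, so it is tested against a finite net of the orbit. Each `π u ζ` lies
    -- within `‖ζ‖ / 2` of some `π v ζ`, hence their inner product has modulus at least `‖ζ‖ ^ 2 /
    -- 2`, and this one summand gives the bound.
    have := hmem {X | ‖ζ‖ ^ 4 / 4 ≤ ∑ v ∈ t, (⟪π v ζ, X (π v ζ)⟫_ℂ).re} ?_ ?_ fun u => ?_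
    · rintro rfl
      have h4 : 0 < ‖ζ‖ ^ 4 := by positivity
      simp only [Set.mem_ofPred_eq, zero_apply, inner_zero_right, Complex.zero_re,
        Finset.sum_const_zero] at this
      linarith
    · intro X hX Y hY a b ha hb hab
      simp only [Set.mem_ofPred_eq] at hX hY ⊢
      have : ∑ v ∈ t, (⟪π v ζ, (a • X + b • Y) (π v ζ)⟫_ℂ).re =
          a * ∑ v ∈ t, (⟪π v ζ, X (π v ζ)⟫_ℂ).re + b * ∑ v ∈ t, (⟪π v ζ, Y (π v ζ)⟫_ℂ).re := by
        rw [Finset.mul_sum, Finset.mul_sum, ← Finset.sum_add_distrib]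
        refine Finset.sum_congr rfl fun v _ => ?_
        simp
      rw [this]
      calc ‖ζ‖ ^ 4 / 4 = a * (‖ζ‖ ^ 4 / 4) + b * (‖ζ‖ ^ 4 / 4) := by rw [← add_mul, hab, one_mul]
        _ ≤ _ := by gcongr
    · refine isClosed_le continuous_const ?_
      fun_prop
    · obtain ⟨v, hv, huv⟩ := ht u
      have hval : ∀ w : unitary B, (⟪π w ζ, P u (π w ζ)⟫_ℂ).re = ‖⟪π u ζ, π w ζ⟫_ℂ‖ ^ 2 := by
        intro w
        rw [InnerProductSpace.rankOne_apply, inner_smul_right, ← inner_conj_symm (π w ζ) (π u ζ),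
          RCLike.mul_conj]
        norm_cast
      simp only [Set.mem_ofPred_eq, hval]
      refine le_trans ?_ (Finset.single_le_sum (f := fun w : unitary B =>
        ‖⟪π u ζ, π w ζ⟫_ℂ‖ ^ 2) (fun _ _ => by positivity) hv)
      rw [dist_eq_norm] at huv
      have h1 := norm_sub_sq (𝕜 := ℂ) (π u ζ) (π v ζ)
      rw [hnorm, hnorm] at h1
      have h2 : (RCLike.re ⟪π u ζ, π v ζ⟫_ℂ) ≤ ‖⟪π u ζ, π v ζ⟫_ℂ‖ := RCLike.re_le_norm _
      have h3 : ‖π u ζ - π v ζ‖ ^ 2 ≤ (‖ζ‖ / 2) ^ 2 := by gcongr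
      have h4 : ‖ζ‖ ^ 2 / 2 ≤ ‖⟪π u ζ, π v ζ⟫_ℂ‖ := by nlinarith [sq_nonneg ‖ζ‖]
      calc ‖ζ‖ ^ 4 / 4 = (‖ζ‖ ^ 2 / 2) ^ 2 := by ring
        _ ≤ _ := by gcongr
  have hcomm : ∀ b, π b * K = K * π b := by
    intro b
    have hb : b ∈ Submodule.span ℂ (unitary B : Set B) := by
      rw [CStarAlgebra.span_unitary]; trivial
    induction hb using Submodule.span_induction with
    | mem u hu =>
      have h := hfix ⟨u, hu⟩
      rw [hTapp] at h
      have h1 : π (star u) * π u = 1 := by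
        rw [← map_mul, Unitary.star_mul_self_of_mem hu, map_one]
      calc π u * K = π u * (K * (π (star u) * π u)) := by rw [h1, mul_one]
        _ = (π u * (K * π (star u))) * π u := by simp only [mul_assoc]
        _ = K * π u := by rw [h]
    | zero => simp
    | add x y _ _ hx hy => rw [map_add, add_mul, mul_add, hx, hy]
    | smul c x _ hx => rw [map_smul, smul_mul_assoc, mul_smul_comm, hx]
  have hex : ∃ μ, Module.End.HasEigenvalue (K : Module.End ℂ H) μ ∧ μ ≠ 0 := by
    by_contra! hcon
    exact hK0 ((ContinuousLinearMap.eq_zero_of_forall_hasEigenvalue_eq_zero hKc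
      hKs.isSymmetric).1 hcon)
  obtain ⟨μ, hμ, hμ0⟩ := hex
  refine ⟨Module.End.eigenspace (K : Module.End ℂ H) μ, ?_, hμ,
    ContinuousLinearMap.finite_dimensional_eigenspace hKc μ hμ0, ?_⟩
  · intro w hw
    rw [Module.End.mem_eigenspace_iff] at hw
    have : w = μ⁻¹ • K w := by
      rw [show K w = μ • w from hw, smul_smul, inv_mul_cancel₀ hμ0, one_smul]
    rw [this]
    exact N.smul_mem _ (hKN w)
  · intro b w hw
    rw [Module.End.mem_eigenspace_iff] at hw ⊢
    have h := ContinuousLinearMap.ext_iff.1 (hcomm b) w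
    calc K (π b w) = π b (K w) := h.symm
      _ = π b (μ • w) := by rw [show K w = μ • w from hw]
      _ = μ • π b w := map_smul _ _ _

/-- If all orbits of the unitary group under a representation on a Hilbert space are totally
bounded, then the finite dimensional invariant subspaces detect the nonzero operators. -/
theorem exists_finiteDimensional_invariant_ne_zero (π : B →⋆ₐ[ℂ] (H →L[ℂ] H))
    (htb : ∀ ζ, TotallyBounded (Set.range fun u : unitary B => π u ζ)) {b : B} (hb : π b ≠ 0) :
    ∃ W : Submodule ℂ H, FiniteDimensional ℂ W ∧ (∀ b, ∀ w ∈ W, π b w ∈ W) ∧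
      ∃ w ∈ W, π b w ≠ 0 := by
  by_contra! hcon
  -- If the orthogonal complement of the span of these subspaces were nonzero, it would contain
  -- another one of them. So they span a dense subspace.
  let S : Set (Submodule ℂ H) := {W | FiniteDimensional ℂ W ∧ ∀ b, ∀ w ∈ W, π b w ∈ W}
  have hNinv : ∀ b, ∀ x ∈ (sSup S)ᗮ, π b x ∈ (sSup S)ᗮ := by
    intro c x hx
    have : sSup S ≤ (sSup S).comap (π (star c) : H →ₗ[ℂ] H) := sSup_le fun W hW w hw =>
      le_sSup hW (hW.2 _ w hw)
    rw [Submodule.mem_orthogonal] at hx ⊢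
    intro w hw
    have h := hx _ (this hw)
    rwa [ContinuousLinearMap.coe_coe, map_star, ContinuousLinearMap.star_eq_adjoint,
      ContinuousLinearMap.adjoint_inner_left] at h
  have hN : (sSup S)ᗮ = ⊥ := by
    by_contra hne
    obtain ⟨ζ, hζ, hζ0⟩ := Submodule.exists_mem_ne_zero_of_ne_bot hne
    obtain ⟨W, hWN, hW0, hWf, hWi⟩ := exists_finiteDimensional_invariant π _
      (Submodule.isClosed_orthogonal _) hNinv hζ hζ0 (htb ζ)
    refine hW0 (eq_bot_iff.2 fun w hw => ?_)
    have h1 : w ∈ sSup S := le_sSup (show W ∈ S from ⟨hWf, hWi⟩) hw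
    exact (Submodule.mem_bot ℂ).2 (inner_self_eq_zero.1 (hWN hw w h1))
  have hker : sSup S ≤ LinearMap.ker (π b : H →ₗ[ℂ] H) :=
    sSup_le fun W hW w hw => hcon W hW.1 hW.2 w hw
  refine hb ((ContinuousLinearMap.ext fun x => ?_))
  have hx : x ∈ (sSup S).topologicalClosure := by
    rw [Submodule.topologicalClosure_eq_top_iff.2 hN]; trivial
  exact (Submodule.topologicalClosure_minimal _ hker (π b).isClosed_ker) hx

/-- The restriction of a representation to a finite dimensional invariant subspace. -/
theorem exists_finiteDimensional_compression (π : B →⋆ₐ[ℂ] (H →L[ℂ] H)) (W : Submodule ℂ H)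
    [FiniteDimensional ℂ W] (hW : ∀ b, ∀ w ∈ W, π b w ∈ W) :
    ∃ (n : ℕ) (ρ : B →⋆ₙₐ[ℂ] (EuclideanSpace ℂ (Fin n) →L[ℂ] EuclideanSpace ℂ (Fin n))),
      ∀ b, ρ b = 0 ↔ ∀ w ∈ W, π b w = 0 := by
  let e := (stdOrthonormalBasis ℂ W).repr
  let V : EuclideanSpace ℂ (Fin (Module.finrank ℂ W)) →L[ℂ] H :=
    (W.subtypeₗᵢ.comp e.symm.toLinearIsometry).toContinuousLinearMap
  have hVmem : ∀ x, V x ∈ W := fun x => (e.symm x).2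
  have hVsurj : ∀ w ∈ W, ∃ x, V x = w := fun w hw => ⟨e ⟨w, hw⟩, by simp [V]⟩
  have hVV : V.adjoint ∘L V = 1 :=
    (W.subtypeₗᵢ.comp e.symm.toLinearIsometry).adjoint_comp_self
  -- Since `V V*` is the identity on the invariant subspace `W`, the compression `V* π(·) V` is
  -- multiplicative.
  have hVV' : ∀ w ∈ W, V (V.adjoint w) = w := by
    intro w hw
    obtain ⟨x, rfl⟩ := hVsurj w hw
    exact congrArg V (ContinuousLinearMap.ext_iff.1 hVV x)
  refine ⟨Module.finrank ℂ W,
    { toFun := fun b => V.adjoint ∘L (π b ∘L V)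
      map_smul' := ?_
      map_zero' := ?_
      map_add' := ?_
      map_mul' := ?_
      map_star' := ?_ }, fun b => ⟨fun h w hw => ?_, fun h => ?_⟩⟩
  · intro c b
    ext1 x
    simp
  · ext1 x
    simp
  · intro a b
    ext1 x
    simp
  · intro a b
    ext1 x
    simp [hVV' _ (hW b _ (hVmem x))]
  · intro b
    rw [map_star, ContinuousLinearMap.star_eq_adjoint, ContinuousLinearMap.star_eq_adjoint,
      ContinuousLinearMap.adjoint_comp, ContinuousLinearMap.adjoint_comp,
      ContinuousLinearMap.adjoint_adjoint, ContinuousLinearMap.comp_assoc]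
  · obtain ⟨x, rfl⟩ := hVsurj w hw
    have := congrArg V (ContinuousLinearMap.ext_iff.1 h x)
    simpa [hVV' _ (hW b _ (hVmem x))] using this
  · ext1 x
    simp [h _ (hVmem x)]

end HilbertSpaceRepresentation

/-! ### Invariant positive forms from almost periodic functionals. -/

section AlmostPeriodicFunctional

open scoped InnerProductSpace ComplexOrder

variable {B : Type*} [CStarAlgebra B]

/-- The positive sesquilinear form `(c, c') ↦ conj (L c) * L c'` of a functional `L`. -/
noncomputable def functionalForm {V : Type*} [SeminormedAddCommGroup V] [NormedSpace ℂ V]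
    (L : V →L[ℂ] ℂ) : V →L⋆[ℂ] V →L[ℂ] ℂ :=
  (innerSL ℂ : ℂ →L⋆[ℂ] ℂ →L[ℂ] ℂ).bilinearComp L L

theorem functionalForm_apply {V : Type*} [SeminormedAddCommGroup V] [NormedSpace ℂ V]
    (L : V →L[ℂ] ℂ) (c c' : V) :
    functionalForm L c c' = star (L c) * L c' := by
  simp [functionalForm, mul_comm]

theorem norm_functionalForm_sub_le {V : Type*} [SeminormedAddCommGroup V] [NormedSpace ℂ V]
    (L M : V →L[ℂ] ℂ) :
    ‖functionalForm L - functionalForm M‖ ≤ (‖L‖ + ‖M‖) * ‖L - M‖ := by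
  refine ContinuousLinearMap.opNorm_le_bound₂ _ (by positivity) fun c c' => ?_
  have h : (functionalForm L - functionalForm M) c c' =
      star (L c) * (L - M) c' + star ((L - M) c) * M c' := by
    simp only [sub_apply, functionalForm_apply, star_sub]
    ring
  rw [h]
  calc ‖star (L c) * (L - M) c' + star ((L - M) c) * M c'‖
      ≤ ‖L c‖ * ‖(L - M) c'‖ + ‖(L - M) c‖ * ‖M c'‖ := by
        refine (norm_add_le _ _).trans_eq ?_
        rw [norm_mul, norm_mul, norm_star, norm_star]
    _ ≤ (‖L‖ * ‖c‖) * (‖L - M‖ * ‖c'‖) + (‖L - M‖ * ‖c‖) * (‖M‖ * ‖c'‖) := by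
        gcongr <;> exact ContinuousLinearMap.le_opNorm _ _
    _ = _ := by ring

/-- The left translate `c ↦ G (b * c)` of a functional. -/
noncomputable def leftTranslate (G : B →L[ℂ] ℂ) (b : B) : B →L[ℂ] ℂ :=
  G ∘L ContinuousLinearMap.mul ℂ B b

@[simp]
theorem leftTranslate_apply (G : B →L[ℂ] ℂ) (b c : B) : leftTranslate G b c = G (b * c) := rfl

theorem norm_leftTranslate_le (G : B →L[ℂ] ℂ) (u : unitary B) : ‖leftTranslate G u‖ ≤ ‖G‖ := by
  refine ContinuousLinearMap.opNorm_le_bound _ (norm_nonneg _) fun c => ?_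
  have := G.le_opNorm (u * c)
  rwa [CStarRing.norm_coe_unitary_mul] at this

/-- Averaging the squares of the translates of an almost periodic functional gives a positive form
which is invariant under left multiplication by unitaries. -/
theorem exists_invariant_form (G : B →L[ℂ] ℂ)
    (htb : TotallyBounded (Set.range fun u : unitary B => leftTranslate G (u : B))) :
    ∃ β : B →L⋆[ℂ] B →L[ℂ] ℂ, (∀ a c c', β (a * c) c' = β c (star a * c')) ∧
      (∀ c, 0 ≤ β c c) ∧
      (∀ c M, (∀ u : unitary B, ‖G (u * c)‖ ^ 2 ≤ M) → (β c c).re ≤ M) ∧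
      (∀ c, G c ≠ 0 → β c c ≠ 0) := by
  let P : unitary B → B →L⋆[ℂ] B →L[ℂ] ℂ := fun u => functionalForm (leftTranslate G (u : B))
  have hPapp : ∀ u c c', P u c c' = star (G (u * c)) * G (u * c') := fun u c c' => by
    simp only [P, functionalForm_apply, leftTranslate_apply]
  have hPself : ∀ u c, P u c c = ((‖G (u * c)‖ ^ 2 : ℝ) : ℂ) := fun u c => by
    rw [hPapp, Complex.star_def, Complex.conj_mul']
    norm_cast
  have hP : TotallyBounded (Set.range P) := by
    refine (totallyBounded_range_iff (X := B →L⋆[ℂ] B →L[ℂ] ℂ)).2 fun ε hε => ?_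
    obtain ⟨t, ht⟩ := totallyBounded_range_iff.1 htb (ε / (2 * ‖G‖ + 1)) (by positivity)
    refine ⟨t, fun u => ?_⟩
    obtain ⟨v, hv, huv⟩ := ht u
    refine ⟨v, hv, ?_⟩
    rw [dist_eq_norm] at huv
    refine (dist_eq_norm (P u) (P v)).trans_lt ?_
    refine (norm_functionalForm_sub_le _ _).trans_lt ?_
    rw [lt_div_iff₀ (by positivity)] at huv
    have h1 := norm_leftTranslate_le G u
    have h2 := norm_leftTranslate_le G v
    nlinarith [norm_nonneg (leftTranslate G u - leftTranslate G v)]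
  let T : unitary B → (B →L⋆[ℂ] B →L[ℂ] ℂ) →ₗ[ℝ] (B →L⋆[ℂ] B →L[ℂ] ℂ) := fun v =>
    { toFun := fun β => β.bilinearComp (ContinuousLinearMap.mul ℂ B v)
        (ContinuousLinearMap.mul ℂ B v)
      map_add' := fun _ _ => by ext; simp
      map_smul' := fun _ _ => by ext; simp }
  have hTapp : ∀ v β c c', T v β c c' = β (v * c) (v * c') := fun v β c c' => rfl
  have hTinv : ∀ v β, T v (T (star v) β) = β := by
    intro v β
    ext c c'
    simp [hTapp, ← mul_assoc]
  have hTle : ∀ v β, ‖T v β‖ ≤ ‖β‖ := fun v β =>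
    ContinuousLinearMap.opNorm_le_bound₂ _ (norm_nonneg β) fun c c' => by
      rw [hTapp]
      have := β.le_opNorm₂ (v * c) (v * c')
      rwa [CStarRing.norm_coe_unitary_mul, CStarRing.norm_coe_unitary_mul] at this
  have hTnorm : ∀ v β, ‖T v β‖ = ‖β‖ := fun v β => by
    refine (hTle v β).antisymm ?_
    have h := hTinv (star v) β
    rw [star_star] at h
    rw [← h]
    simpa [h] using hTle (star v) (T v β)
  have hTP : ∀ v u, T v (P u) = P (u * v) := by
    intro v u
    ext c c'
    simp [hTapp, hPapp, mul_assoc]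
  obtain ⟨β, hβ, hfix⟩ := hP.exists_fixed_mem_closure (Set.range_nonempty P) T hTnorm
    (fun v => ⟨star v, hTinv v⟩) (by rintro v _ ⟨u, rfl⟩; exact ⟨u * v, (hTP v u).symm⟩)
  have hmem : ∀ S : Set (B →L⋆[ℂ] B →L[ℂ] ℂ), Convex ℝ S → IsClosed S → (∀ u, P u ∈ S) → β ∈ S :=
    fun S hS hS' hPS => closure_minimal (convexHull_min (Set.range_subset_iff.2 hPS) hS) hS' hβ
  have hpos : ∀ c, 0 ≤ β c c := by
    intro c
    refine hmem {X | 0 ≤ X c c} ?_ (isClosed_le continuous_const (by fun_prop)) fun u => ?_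
    · intro X hX Y hY a b ha hb _
      simp only [Set.mem_ofPred_eq] at hX hY ⊢
      exact add_nonneg (smul_nonneg ha hX) (smul_nonneg hb hY)
    · simp only [Set.mem_ofPred_eq, hPself]
      exact Complex.zero_le_real.2 (sq_nonneg _)
  refine ⟨β, ?_, hpos, ?_, ?_⟩
  · intro a c c'
    have ha : a ∈ Submodule.span ℂ (unitary B : Set B) := by
      rw [CStarAlgebra.span_unitary]; trivial
    induction ha using Submodule.span_induction with
    | mem u hu =>
      -- Invariance under a unitary `u` becomes the adjoint relation, which is linear in `u` in the
      -- right sense to extend to the span of the unitaries, that is, to the whole algebra.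
      have h := congrArg (fun X => X c (star u * c')) (hfix ⟨u, hu⟩)
      simp only [hTapp] at h
      rwa [← mul_assoc u, Unitary.mul_star_self_of_mem hu, one_mul] at h
    | zero => simp
    | add x y _ _ hx hy => simp [add_mul, hx, hy]
    | smul r x _ hx => simp [hx]
  · intro c M hM
    refine hmem {X | (X c c).re ≤ M} ?_ (isClosed_le (by fun_prop) continuous_const) fun u => ?_
    · intro X hX Y hY a b ha hb hab
      simp only [Set.mem_ofPred_eq] at hX hY ⊢
      calc ((a • X + b • Y) c c).re = a * (X c c).re + b * (Y c c).re := by simp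
        _ ≤ a * M + b * M := by gcongr
        _ = M := by rw [← add_mul, hab, one_mul]
    · simp only [Set.mem_ofPred_eq, hPself, Complex.ofReal_re]
      exact hM u
  · intro c hc h0
    have hc' : 0 < ‖G c‖ := norm_pos_iff.2 hc
    obtain ⟨t, ht⟩ := totallyBounded_range_iff.1 htb (‖G c‖ / (2 * (‖c‖ + 1))) (by positivity)
    -- If the translate by `u` is close to that by `v`, then `G (u * (star v * c))` is close to `G
    -- (v * (star v * c)) = G c`. For the invariant `β`, every summand equals the real part of `β c
    -- c`, so that value cannot be zero.
    have := hmem {X | ‖G c‖ ^ 2 / 4 ≤ ∑ v ∈ t, (X (star (v : B) * c) (star (v : B) * c)).re}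
      ?_ (isClosed_le continuous_const (by fun_prop)) fun u => ?_
    · have h1 : ∀ v : unitary B, β (star (v : B) * c) (star (v : B) * c) = 0 := fun v => by
        rw [← h0]
        exact congrArg (fun X => X c c) (hfix (star v))
      simp only [Set.mem_ofPred_eq, h1, Complex.zero_re, Finset.sum_const_zero] at this
      have : 0 < ‖G c‖ ^ 2 := by positivity
      linarith
    · intro X hX Y hY a b ha hb hab
      simp only [Set.mem_ofPred_eq] at hX hY ⊢
      have hsum : ∑ v ∈ t, ((a • X + b • Y) (star (v : B) * c) (star (v : B) * c)).re =
          a * ∑ v ∈ t, (X (star (v : B) * c) (star (v : B) * c)).re +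
            b * ∑ v ∈ t, (Y (star (v : B) * c) (star (v : B) * c)).re := by
        rw [Finset.mul_sum, Finset.mul_sum, ← Finset.sum_add_distrib]
        refine Finset.sum_congr rfl fun v _ => ?_
        simp
      rw [hsum]
      calc ‖G c‖ ^ 2 / 4 = a * (‖G c‖ ^ 2 / 4) + b * (‖G c‖ ^ 2 / 4) := by
            rw [← add_mul, hab, one_mul]
        _ ≤ _ := by gcongr
    · obtain ⟨v, hv, huv⟩ := ht u
      simp only [Set.mem_ofPred_eq, hPself, Complex.ofReal_re]
      refine le_trans ?_ (Finset.single_le_sum (f := fun v : unitary B =>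
        ‖G (u * (star (v : B) * c))‖ ^ 2) (fun _ _ => by positivity) hv)
      rw [dist_eq_norm] at huv
      have h1 := (leftTranslate G (u : B) - leftTranslate G (v : B)).le_opNorm (star (v : B) * c)
      rw [sub_apply, leftTranslate_apply, leftTranslate_apply, ← mul_assoc (v : B),
        Unitary.mul_star_self_of_mem v.2, one_mul, ← Unitary.coe_star,
        CStarRing.norm_coe_unitary_mul] at h1
      have h2 : ‖leftTranslate G (u : B) - leftTranslate G (v : B)‖ * ‖c‖ ≤ ‖G c‖ / 2 := by
        rw [lt_div_iff₀ (by positivity)] at huv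
        nlinarith [norm_nonneg (leftTranslate G (u : B) - leftTranslate G (v : B))]
      have h3 : ‖G c‖ / 2 ≤ ‖G (u * (star (v : B) * c))‖ := by
        have := norm_sub_norm_le (G c) (G (u * ((star v : unitary B) * c)))
        rw [norm_sub_rev] at this
        rw [← Unitary.coe_star]
        linarith
      calc ‖G c‖ ^ 2 / 4 = (‖G c‖ / 2) ^ 2 := by ring
        _ ≤ _ := by gcongr

end AlmostPeriodicFunctional

/-! ### The GNS representation of the invariant form. -/

section AlmostPeriodicRepresentation

open scoped InnerProductSpace ComplexOrder

variable {B : Type*} [CStarAlgebra B]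

theorem totallyBounded_orbit_of_dense {H : Type*} [NormedAddCommGroup H] [InnerProductSpace ℂ H]
    [CompleteSpace H] (π : B →⋆ₐ[ℂ] (H →L[ℂ] H)) {D : Set H} (hD : Dense D)
    (htb : ∀ ζ ∈ D, TotallyBounded (Set.range fun u : unitary B => π u ζ)) (ζ : H) :
    TotallyBounded (Set.range fun u : unitary B => π u ζ) := by
  refine totallyBounded_range_iff.2 fun ε hε => ?_
  obtain ⟨η, hη, hζη⟩ := Metric.dense_iff.1 hD ζ (ε / 3) (by positivity)
  obtain ⟨t, ht⟩ := totallyBounded_range_iff.1 (htb η hζη) (ε / 3) (by positivity)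
  refine ⟨t, fun u => ?_⟩
  obtain ⟨v, hv, huv⟩ := ht u
  refine ⟨v, hv, ?_⟩
  have h : ∀ w : unitary B, dist (π w ζ) (π w η) < ε / 3 := fun w => by
    rw [dist_eq_norm, ← map_sub, norm_unitary_rep_apply, ← dist_eq_norm, dist_comm]
    exact hη
  calc dist (π u ζ) (π v ζ) ≤ dist (π u ζ) (π u η) + dist (π u η) (π v η) + dist (π v η) (π v ζ) :=
        dist_triangle4 _ _ _ _
    _ < ε / 3 + ε / 3 + ε / 3 := by
        gcongr
        · exact h u
        · rw [dist_comm]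
          exact h v
    _ = ε := by ring

/-- A functional whose left translates by unitaries form a totally bounded set is detected by finite
dimensional representations. -/
theorem exists_finiteDimensional_rep_of_totallyBounded_leftTranslate (G : B →L[ℂ] ℂ)
    (htb : TotallyBounded (Set.range fun u : unitary B => leftTranslate G (u : B)))
    {b : B} (hb : G b ≠ 0) :
    ∃ (n : ℕ) (ρ : B →⋆ₙₐ[ℂ] (EuclideanSpace ℂ (Fin n) →L[ℂ] EuclideanSpace ℂ (Fin n))),
      ρ b ≠ 0 ∧ ∀ c, (∀ a d, G (a * c * d) = 0) → ρ c = 0 := by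
  let _ := CStarAlgebra.spectralOrder B
  let _ := CStarAlgebra.spectralOrderedRing B
  obtain ⟨β, hinv, hpos, hle, hne⟩ := exists_invariant_form G htb
  have hβ : ∀ c c', β 1 (star c * c') = β c c' := fun c c' => by
    rw [← hinv, mul_one]
  let f : B →ₚ[ℂ] ℂ := PositiveLinearMap.mk₀ (β 1 : B →ₗ[ℂ] ℂ) fun a ha => by
    obtain ⟨c, rfl⟩ := CStarAlgebra.nonneg_iff_eq_star_mul_self.1 ha
    simpa [hβ] using hpos c
  have hf : ∀ c c', f (star c * c') = β c c' := hβ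
  let ι : B → f.GNS := fun c => ((f.toPreGNS c : f.PreGNS) : f.GNS)
  have hιdense : DenseRange ι :=
    (UniformSpace.Completion.denseRange_coe (α := f.PreGNS)).comp
      f.toPreGNS.surjective.denseRange (UniformSpace.Completion.continuous_coe _)
  have hιnorm : ∀ c, ‖ι c‖ ^ 2 = (β c c).re := fun c => by
    have h := f.preGNS_norm_sq (f.toPreGNS c)
    rw [f.ofPreGNS_toPreGNS, hf] at h
    rw [UniformSpace.Completion.norm_coe, ← h]
    norm_cast
  have hιsub : ∀ c d, ι c - ι d = ι (c - d) := fun c d => by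
    simp only [ι, map_sub, UniformSpace.Completion.coe_sub]
  let π := f.gnsStarAlgHom
  have hπ : ∀ a c, π a (ι c) = ι (a * c) := fun a c => by
    simp [π, ι]
  have horb : ∀ ζ, TotallyBounded (Set.range fun u : unitary B => π u ζ) := by
    refine totallyBounded_orbit_of_dense π hιdense ?_
    rintro _ ⟨d, rfl⟩
    refine totallyBounded_range_of_forall_exists fun ε hε => ?_
    obtain ⟨t, ht⟩ := totallyBounded_range_iff.1 htb (ε / (8 * (‖d‖ + 1))) (by positivity)
    -- The GNS norm of `ι (u * d - v * d)` is at most the supremum over unitaries `w` of `‖G (w * (u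
    -- * d - v * d))‖`. Almost periodicity replaces `w` by a member of the finite net `t`, so
    -- finitely many bounded coordinates control the orbit.
    refine ⟨t.card, fun u i => G ((t.equivFin.symm i : unitary B) * (u * d)), ε / 4, by positivity,
      ?_, fun u v huv => ?_⟩
    · refine isBounded_iff_forall_norm_le.2 ⟨‖G‖ * ‖d‖, ?_⟩
      rintro _ ⟨u, rfl⟩
      refine (pi_norm_le_iff_of_nonneg (by positivity)).2 fun i => ?_
      refine (G.le_opNorm _).trans_eq ?_
      rw [CStarRing.norm_coe_unitary_mul, CStarRing.norm_coe_unitary_mul]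
    · have hd : ‖(u * d - v * d : B)‖ ≤ 2 * ‖d‖ := by
        refine (norm_sub_le _ _).trans_eq ?_
        rw [CStarRing.norm_coe_unitary_mul, CStarRing.norm_coe_unitary_mul]
        ring
      have hkey : ∀ w : unitary B, ‖G (w * (u * d - v * d))‖ ≤ ε / 2 := by
        intro w
        obtain ⟨x, hx, hwx⟩ := ht w
        rw [dist_eq_norm] at hwx
        have h1 := (leftTranslate G (w : B) - leftTranslate G (x : B)).le_opNorm (u * d - v * d)
        rw [sub_apply, leftTranslate_apply, leftTranslate_apply] at h1
        have h2 : ‖G (x * (u * d - v * d))‖ ≤ ε / 4 := by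
          have h3 := (dist_le_pi_dist _ _ (t.equivFin ⟨x, hx⟩)).trans huv.le
          rw [dist_eq_norm] at h3
          simpa [mul_sub] using h3
        have h4 : ‖leftTranslate G (w : B) - leftTranslate G (x : B)‖ * ‖(u * d - v * d : B)‖ ≤
            ε / 4 := by
          rw [lt_div_iff₀ (by positivity)] at hwx
          nlinarith [norm_nonneg (leftTranslate G (w : B) - leftTranslate G (x : B))]
        have h5 := norm_le_norm_add_norm_sub' (G (w * (u * d - v * d))) (G (x * (u * d - v * d)))
        linarith
      have hsq : ‖ι (u * d - v * d)‖ ^ 2 ≤ (ε / 2) ^ 2 := by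
        rw [hιnorm]
        refine hle _ _ fun w => ?_
        gcongr
        exact hkey w
      have := le_of_sq_le_sq hsq (by positivity)
      rw [hπ, hπ, dist_eq_norm, hιsub]
      linarith
  have hπb : π b ≠ 0 := fun h0 => by
    have h1 : ι b = 0 := by rw [← mul_one b, ← hπ, h0]; rfl
    have h2 := hιnorm b
    have h3 := hpos b
    refine hne b hb (Complex.ext ?_ ?_)
    · rw [← h2, h1]; simp
    · exact (Complex.le_def.1 h3).2.symm
  obtain ⟨W, hWf, hWi, w, hw, hbw⟩ := exists_finiteDimensional_invariant_ne_zero π horb hπb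
  obtain ⟨n, ρ, hρ⟩ := exists_finiteDimensional_compression π W hWi
  refine ⟨n, ρ, fun h0 => hbw ((hρ b).1 h0 w hw), fun c hc => (hρ c).2 fun x _ => ?_⟩
  have h0 : π c = 0 := by
    refine ContinuousLinearMap.ext fun x => ?_
    refine congrFun (hιdense.equalizer (π c).continuous (0 : f.GNS →L[ℂ] f.GNS).continuous ?_) x
    funext d
    rw [Function.comp_apply, Function.comp_apply, hπ, zero_apply]
    -- The form is bounded by the values of `G` on translates, so the hypothesis on `c` makes `π c`
    -- vanish on the dense range of `ι`.
    have h1 := hle (c * d) 0 fun u => by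
      rw [← mul_assoc, hc]
      simp
    rw [← hιnorm] at h1
    exact norm_eq_zero.1 (pow_eq_zero_iff two_ne_zero |>.1 (le_antisymm h1 (by positivity)))
  rw [h0, zero_apply]

end AlmostPeriodicRepresentation

/-! ### Passage to the unitization, and representations detecting `φ`. -/

open scoped Pointwise in
theorem TotallyBounded.add_set {V : Type*} [SeminormedAddCommGroup V] {s t : Set V}
    (hs : TotallyBounded s) (ht : TotallyBounded t) : TotallyBounded (s + t) := by
  refine Metric.totallyBounded_iff.2 fun ε hε => ?_
  obtain ⟨s', hs'f, hs'⟩ := Metric.totallyBounded_iff.1 hs (ε / 2) (half_pos hε)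
  obtain ⟨t', ht'f, ht'⟩ := Metric.totallyBounded_iff.1 ht (ε / 2) (half_pos hε)
  refine ⟨s' + t', hs'f.add ht'f, ?_⟩
  rintro _ ⟨x, hx, y, hy, rfl⟩
  obtain ⟨x', hx', hxx'⟩ := Set.mem_iUnion₂.1 (hs' hx)
  obtain ⟨y', hy', hyy'⟩ := Set.mem_iUnion₂.1 (ht' hy)
  refine Set.mem_iUnion₂.2 ⟨x' + y', Set.add_mem_add hx' hy', ?_⟩
  rw [Metric.mem_ball] at hxx' hyy' ⊢
  exact (dist_add_add_le _ _ _ _).trans_lt (by linarith)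

section Unitization

variable {A : Type*} [NonUnitalCStarAlgebra A]

theorem Unitization.norm_fst_le (b : Unitization ℂ A) : ‖b.fst‖ ≤ ‖b‖ := by
  rw [Unitization.norm_eq_sup]
  exact le_sup_left

theorem Unitization.norm_snd_le (b : Unitization ℂ A) : ‖b.snd‖ ≤ 2 * ‖b‖ := by
  have h : (b.snd : Unitization ℂ A) = b - algebraMap ℂ (Unitization ℂ A) b.fst := by
    rw [Unitization.algebraMap_eq_inl]
    exact eq_sub_of_add_eq' b.inl_fst_add_inr_snd_eq
  rw [← Unitization.norm_inr (𝕜 := ℂ), h, two_mul]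
  refine (norm_sub_le _ _).trans ?_
  gcongr
  rw [norm_algebraMap']
  exact b.norm_fst_le

/-- If a linear map on a C⋆-algebra sends the unit ball to a totally bounded set, then so do its
linear extensions to the unitization. -/
theorem TotallyBounded.image_unitization {V : Type*} [NormedAddCommGroup V] [NormedSpace ℂ V]
    (T : A →ₗ[ℂ] V) (v : V) (h : TotallyBounded (T '' Metric.closedBall 0 1)) :
    TotallyBounded ((fun b : Unitization ℂ A => b.fst • v + T b.snd) '' Metric.closedBall 0 1) := by
  have h1 : TotallyBounded ((fun c : ℂ => c • v) '' Metric.closedBall 0 1) :=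
    ((isCompact_closedBall (0 : ℂ) 1).image (by fun_prop)).totallyBounded
  have h2 : TotallyBounded ((fun w : V => (2 : ℂ) • w) '' (T '' Metric.closedBall 0 1)) :=
    h.image (uniformContinuous_const_smul (2 : ℂ))
  refine (h1.add_set h2).subset ?_
  rintro _ ⟨b, hb, rfl⟩
  rw [mem_closedBall_zero_iff] at hb
  refine ⟨_, ⟨b.fst, ?_, rfl⟩, _, ⟨_, ⟨(2⁻¹ : ℂ) • b.snd, ?_, rfl⟩, rfl⟩, ?_⟩
  · rw [mem_closedBall_zero_iff]
    exact b.norm_fst_le.trans hb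
  · rw [mem_closedBall_zero_iff, norm_smul]
    have := b.norm_snd_le
    norm_num
    linarith
  · simp

/-- The unital extension of a bounded homomorphism is bounded. -/
theorem exists_norm_toAlgHom_le {E : Type*} [NormedAddCommGroup E] [NormedSpace ℂ E]
    (φ : A →ₙₐ[ℂ] (E →L[ℂ] E)) (hφ : ∃ C : ℝ, ∀ a, ‖φ a‖ ≤ C * ‖a‖) :
    ∃ C : ℝ, 0 ≤ C ∧ ∀ b, ‖NonUnitalAlgHom.toAlgHom φ b‖ ≤ C * ‖b‖ := by
  obtain ⟨C, hC⟩ := hφ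
  refine ⟨1 + 2 * |C|, by positivity, fun b => ?_⟩
  have h1 : ‖algebraMap ℂ (E →L[ℂ] E) b.fst‖ ≤ ‖b‖ := by
    refine le_trans ?_ b.norm_fst_le
    rw [Algebra.algebraMap_eq_smul_one, norm_smul]
    exact mul_le_of_le_one_right (norm_nonneg _) ContinuousLinearMap.norm_id_le
  have h2 : ‖φ b.snd‖ ≤ |C| * (2 * ‖b‖) :=
    (hC _).trans (mul_le_mul (le_abs_self C) b.norm_snd_le (norm_nonneg _) (abs_nonneg C))
  calc ‖NonUnitalAlgHom.toAlgHom φ b‖ = ‖algebraMap ℂ (E →L[ℂ] E) b.fst + φ b.snd‖ := rfl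
    _ ≤ ‖b‖ + |C| * (2 * ‖b‖) := (norm_add_le _ _).trans (add_le_add h1 h2)
    _ = _ := by ring

theorem map_star_eq_zero_iff {C D : Type*} [NonUnitalCStarAlgebra C] [NonUnitalCStarAlgebra D]
    (ρ : C →⋆ₙₐ[ℂ] D) (c : C) : ρ (star c) = 0 ↔ ρ c = 0 := by
  rw [map_star, star_eq_zero]

/-- A bounded homomorphism of a C⋆-algebra all of whose orbits of the unit ball are totally bounded
is detected by finite dimensional ⋆-representations. -/
theorem exists_finiteDimensional_rep_of_totallyBounded_orbits {E : Type*} [NormedAddCommGroup E]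
    [NormedSpace ℂ E] (φ : A →ₙₐ[ℂ] (E →L[ℂ] E)) (hφ : ∃ C : ℝ, ∀ a, ‖φ a‖ ≤ C * ‖a‖)
    (htb : ∀ x, TotallyBounded ((fun a => φ a x) '' Metric.closedBall 0 1)) {a : A}
    (ha : φ a ≠ 0) :
    ∃ (n : ℕ) (ρ : A →⋆ₙₐ[ℂ] (EuclideanSpace ℂ (Fin n) →L[ℂ] EuclideanSpace ℂ (Fin n))),
      ρ a ≠ 0 ∧ ∀ c, φ c = 0 → ρ c = 0 := by
  obtain ⟨x, hx⟩ : ∃ x, φ a x ≠ 0 := by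
    by_contra! h
    exact ha (ContinuousLinearMap.ext h)
  obtain ⟨y, hy⟩ := SeparatingDual.exists_ne_zero (R := ℂ) hx
  obtain ⟨C, hC0, hC⟩ := exists_norm_toAlgHom_le φ hφ
  set Φ := NonUnitalAlgHom.toAlgHom φ with hΦ
  have hΦinr : ∀ c : A, Φ (c : Unitization ℂ A) = φ c := fun c => by simp [hΦ]
  have hbound : ∀ (b : Unitization ℂ A) z, ‖star (y (Φ (star b) z))‖ ≤ ‖y‖ * C * ‖z‖ * ‖b‖ := by
    intro b z
    rw [norm_star]
    calc ‖y (Φ (star b) z)‖ ≤ ‖y‖ * (‖Φ (star b)‖ * ‖z‖) :=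
          (y.le_opNorm _).trans (by gcongr; exact ContinuousLinearMap.le_opNorm _ _)
      _ ≤ ‖y‖ * ((C * ‖star b‖) * ‖z‖) := by gcongr; exact hC _
      _ = ‖y‖ * C * ‖z‖ * ‖b‖ := by rw [norm_star]; ring
  -- The two stars keep `G` linear and reverse products: `G (u * b)` is the conjugate of `y (Φ (star
  -- b) (Φ (star u) x))`. So the left translates of `G` depend on `u` only through the vector `Φ
  -- (star u) x`, which moves in a totally bounded set.
  let G : Unitization ℂ A →L[ℂ] ℂ := LinearMap.mkContinuous
    { toFun := fun b => star (y (Φ (star b) x))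
      map_add' := fun b c => by simp
      map_smul' := fun r b => by simp } (‖y‖ * C * ‖x‖) fun b => hbound b x
  have hG : ∀ b, G b = star (y (Φ (star b) x)) := fun b => rfl
  have htbG : TotallyBounded
      (Set.range fun u : unitary (Unitization ℂ A) => leftTranslate G (u : Unitization ℂ A)) := by
    have h1 := TotallyBounded.image_unitization
      ((ContinuousLinearMap.apply ℂ E x : (E →L[ℂ] E) →ₗ[ℂ] E).comp (φ : A →ₗ[ℂ] (E →L[ℂ] E))) x
      (htb x)
    have h2 : TotallyBounded
        (Set.range fun u : unitary (Unitization ℂ A) => Φ (star (u : Unitization ℂ A)) x) := by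
      refine h1.subset ?_
      rintro _ ⟨u, rfl⟩
      refine ⟨star (u : Unitization ℂ A), ?_, ?_⟩
      · rw [mem_closedBall_zero_iff, norm_star]
        exact CStarRing.norm_of_mem_unitary u.2 |>.le
      · simp [hΦ, Algebra.algebraMap_eq_smul_one]
    refine totallyBounded_range_iff.2 fun ε hε => ?_
    obtain ⟨t, ht⟩ := totallyBounded_range_iff.1 h2 (ε / (‖y‖ * C + 1)) (by positivity)
    refine ⟨t, fun u => ?_⟩
    obtain ⟨v, hv, huv⟩ := ht u
    refine ⟨v, hv, ?_⟩
    rw [dist_eq_norm] at huv ⊢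
    have h3 : ‖leftTranslate G (u : Unitization ℂ A) - leftTranslate G (v : Unitization ℂ A)‖ ≤
        ‖y‖ * C * ‖Φ (star (u : Unitization ℂ A)) x - Φ (star (v : Unitization ℂ A)) x‖ := by
      refine ContinuousLinearMap.opNorm_le_bound _ (by positivity) fun b => ?_
      refine le_of_eq_of_le ?_ (hbound b _)
      simp [hG]
    rw [lt_div_iff₀ (by positivity)] at huv
    have := norm_nonneg (Φ (star (u : Unitization ℂ A)) x - Φ (star (v : Unitization ℂ A)) x)
    nlinarith
  have hGa : G ((star a : A) : Unitization ℂ A) ≠ 0 := by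
    rw [hG, ← Unitization.inr_star, star_star, hΦinr]
    exact star_ne_zero.2 hy
  obtain ⟨n, ρ, hρa, hρ⟩ :=
    exists_finiteDimensional_rep_of_totallyBounded_leftTranslate G htbG hGa
  have hstar : ∀ c : A, ρ ((star c : A) : Unitization ℂ A) = 0 ↔ ρ (c : Unitization ℂ A) = 0 :=
    fun c => by
      rw [Unitization.inr_star]
      exact map_star_eq_zero_iff ρ (c : Unitization ℂ A)
  refine ⟨n, ρ.comp (Unitization.inrNonUnitalStarAlgHom ℂ A), fun h => hρa ((hstar a).2 h),
    fun c hc => (hstar c).1 (hρ _ fun b d => ?_)⟩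
  rw [hG, star_mul, star_mul, ← Unitization.inr_star, star_star, map_mul, map_mul, hΦinr, hc]
  simp

end Unitization

/-! ### The quotient by a joint kernel as a C⋆-algebra. -/

section Quotient

variable {A : Type*} [NonUnitalCStarAlgebra A]

/-- An element can be moved into the ball of radius `r` by subtracting an element that lies in the
kernel of every representation in which the element has norm at most `r`. -/
theorem exists_norm_sub_le_forall_map_eq_zero (a : A) {r : ℝ} (hr : 0 < r) :
    ∃ c : A, ‖a - c‖ ≤ r ∧ ∀ {D : Type} [CStarAlgebra D] (ρ : A →⋆ₙₐ[ℂ] D),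
      ‖ρ a‖ ≤ r → ρ c = 0 := by
  let _ := CStarAlgebra.spectralOrder A
  let _ := CStarAlgebra.spectralOrderedRing A
  -- For `c = a k(a* a)`, the difference `a - c` is `a` with its absolute value cut off at `r`: `x
  -- (1 - k x)² = x r² / max x r² ≤ r²` for `x ≥ 0`. As `k` vanishes up to `r²`, a representation
  -- with `‖ρ a‖ ≤ r` kills `c`.
  let k : ℝ → ℝ := fun x => 1 - r / √(max x (r ^ 2))
  have hmax : ∀ x : ℝ, 0 < √(max x (r ^ 2)) := fun x =>
    Real.sqrt_pos.2 (lt_max_of_lt_right (by positivity))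
  have hk : Continuous k := by
    refine continuous_const.sub (continuous_const.div ?_ fun x => (hmax x).ne')
    exact Real.continuous_sqrt.comp (continuous_id.max continuous_const)
  have hk0 : ∀ x ≤ r ^ 2, k x = 0 := fun x hx => by
    simp only [k]
    rw [max_eq_right hx, Real.sqrt_sq hr.le, div_self hr.ne', sub_self]
  have hkz : k 0 = 0 := hk0 0 (by positivity)
  have hh : IsSelfAdjoint (star a * a) := IsSelfAdjoint.star_mul_self a
  refine ⟨a * cfcₙ k (star a * a), ?_, fun {D} _ ρ hρ => ?_⟩
  · have hK : IsSelfAdjoint (cfcₙ k (star a * a)) := cfcₙ_predicate k _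
    have e1 : cfcₙ (fun x => x * k x) (star a * a) = star a * a * cfcₙ k (star a * a) := by
      rw [cfcₙ_mul (fun x : ℝ => x) k (star a * a) continuousOn_id rfl hk.continuousOn hkz,
        cfcₙ_id' ℝ (star a * a) hh]
    have e2 : cfcₙ (fun x => k x * x) (star a * a) = cfcₙ k (star a * a) * (star a * a) := by
      rw [cfcₙ_mul k (fun x : ℝ => x) (star a * a) hk.continuousOn hkz continuousOn_id rfl,
        cfcₙ_id' ℝ (star a * a) hh]
    have e3 : cfcₙ (fun x => k x * x * k x) (star a * a) =
        cfcₙ k (star a * a) * (star a * a) * cfcₙ k (star a * a) := by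
      rw [cfcₙ_mul (fun x => k x * x) k (star a * a) (hk.mul continuous_id).continuousOn (by simp)
        hk.continuousOn hkz, e2]
    have c1 : Continuous fun x => x * k x := continuous_id.mul hk
    have c2 : Continuous fun x => k x * x := hk.mul continuous_id
    have c3 : Continuous fun x => k x * x * k x := c2.mul hk
    have h1 : star (a - a * cfcₙ k (star a * a)) * (a - a * cfcₙ k (star a * a)) =
        cfcₙ (fun x => x - (x * k x + k x * x - k x * x * k x)) (star a * a) := by
      rw [cfcₙ_sub (fun x : ℝ => x) (fun x => x * k x + k x * x - k x * x * k x) (star a * a)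
          continuousOn_id rfl ((c1.add c2).sub c3).continuousOn (by simp [hkz]),
        cfcₙ_sub (fun x => x * k x + k x * x) (fun x => k x * x * k x) (star a * a)
          (c1.add c2).continuousOn (by simp) c3.continuousOn (by simp),
        cfcₙ_add (fun x => x * k x) (fun x => k x * x) (star a * a)
          c1.continuousOn (by simp) c2.continuousOn (by simp),
        e1, e2, e3, cfcₙ_id' ℝ (star a * a) hh, star_sub, star_mul, hK.star_eq]
      simp only [sub_mul, mul_sub, mul_assoc]
      abel
    have h2 : ‖star (a - a * cfcₙ k (star a * a)) * (a - a * cfcₙ k (star a * a))‖ ≤ r ^ 2 := by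
      rw [h1]
      refine norm_cfcₙ_le fun x hx => ?_
      have hx0 : 0 ≤ x := quasispectrum_nonneg_of_nonneg _ (star_mul_self_nonneg a) x hx
      have h3 : x - (x * k x + k x * x - k x * x * k x) = x * r ^ 2 / max x (r ^ 2) := by
        trans x * r ^ 2 / √(max x (r ^ 2)) ^ 2
        swap
        · rw [Real.sq_sqrt (le_max_of_le_left hx0)]
        simp only [k]
        have := (hmax x).ne'
        field_simp
        ring
      have h4 : 0 < max x (r ^ 2) := lt_max_of_lt_right (by positivity)
      rw [h3, Real.norm_of_nonneg (by positivity), div_le_iff₀ h4, mul_comm]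
      gcongr
      exact le_max_left _ _
    rw [CStarRing.norm_star_mul_self, ← sq] at h2
    exact le_of_sq_le_sq h2 hr.le
  · have hρc : Continuous ρ := AddMonoidHomClass.continuous_of_bound ρ 1 fun x => by
      simpa using NonUnitalStarAlgHom.norm_apply_le ρ x
    have hh' : IsSelfAdjoint (star (ρ a) * ρ a) := IsSelfAdjoint.star_mul_self _
    have h1 : ρ (cfcₙ k (star a * a)) = cfcₙ k (star (ρ a) * ρ a) := by
      rw [ρ.map_cfcₙ k _ hk.continuousOn hkz hρc hh (by rw [map_mul, map_star]; exact hh'),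
        map_mul, map_star]
    have h2 : cfcₙ k (star (ρ a) * ρ a) = 0 := by
      rw [← cfcₙ_const_zero ℝ (star (ρ a) * ρ a)]
      refine cfcₙ_congr fun x hx => hk0 x ?_
      refine (le_abs_self x).trans
        ((NonUnitalIsometricContinuousFunctionalCalculus.norm_quasispectrum_le
          (star (ρ a) * ρ a) hx hh').trans ?_)
      rw [CStarRing.norm_star_mul_self, ← sq]
      gcongr
    rw [map_mul, h1, h2, mul_zero]

section Family

variable {ι : Type*} {D : ι → Type} [∀ i, CStarAlgebra (D i)] (ρ : ∀ i, A →⋆ₙₐ[ℂ] D i)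

/-- The distance to the joint kernel of a family of representations is the supremum of the norms in
these representations. -/
theorem infDist_iInter_ker_le_iff (a : A) {s : ℝ} (hs : 0 ≤ s) :
    Metric.infDist a {b | ∀ i, ρ i b = 0} ≤ s ↔ ∀ i, ‖ρ i a‖ ≤ s := by
  refine ⟨fun h i => ?_, fun h => ?_⟩
  · refine le_of_forall_pos_lt_add fun ε hε => ?_
    obtain ⟨c, hc, hac⟩ := (Metric.infDist_lt_iff (show ({b | ∀ i, ρ i b = 0} : Set A).Nonempty
      from ⟨0, fun i => map_zero (ρ i)⟩)).1 (h.trans_lt (lt_add_of_pos_right s hε))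
    rw [← sub_zero (ρ i a), ← hc i, ← map_sub]
    exact (NonUnitalStarAlgHom.norm_apply_le (ρ i) _).trans_lt (by rwa [← dist_eq_norm])
  · refine le_of_forall_pos_le_add fun ε hε => ?_
    obtain ⟨c, hac, hc⟩ := exists_norm_sub_le_forall_map_eq_zero a
      (show 0 < s + ε by positivity)
    have hcI : c ∈ {b | ∀ i, ρ i b = 0} := fun i => hc (ρ i) ((h i).trans (by linarith))
    exact (Metric.infDist_le_dist_of_mem hcI).trans (by rwa [dist_eq_norm])

/-- By `infDist_iInter_ker_le_iff` the quotient norm is a supremum of C⋆-seminorms, so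
submultiplicativity, and likewise the C⋆-inequality below, are inherited from the individual
representations. -/
theorem infDist_iInter_ker_mul_le (a b : A) :
    Metric.infDist (a * b) {b | ∀ i, ρ i b = 0} ≤
      Metric.infDist a {b | ∀ i, ρ i b = 0} * Metric.infDist b {b | ∀ i, ρ i b = 0} := by
  rw [infDist_iInter_ker_le_iff ρ _ (mul_nonneg Metric.infDist_nonneg Metric.infDist_nonneg)]
  intro i
  rw [map_mul]
  refine (norm_mul_le _ _).trans (mul_le_mul ?_ ?_ (norm_nonneg _) Metric.infDist_nonneg)
  · exact (infDist_iInter_ker_le_iff ρ a Metric.infDist_nonneg).1 le_rfl i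
  · exact (infDist_iInter_ker_le_iff ρ b Metric.infDist_nonneg).1 le_rfl i

theorem infDist_iInter_ker_mul_self_le (a : A) :
    Metric.infDist a {b | ∀ i, ρ i b = 0} * Metric.infDist a {b | ∀ i, ρ i b = 0} ≤
      Metric.infDist (star a * a) {b | ∀ i, ρ i b = 0} := by
  rw [← sq]
  refine (Real.le_sqrt Metric.infDist_nonneg Metric.infDist_nonneg).1 ?_
  rw [infDist_iInter_ker_le_iff ρ _ (Real.sqrt_nonneg _)]
  intro i
  refine Real.le_sqrt_of_sq_le ?_
  rw [sq, ← CStarRing.norm_star_mul_self, ← map_star, ← map_mul]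
  exact (infDist_iInter_ker_le_iff ρ (star a * a) Metric.infDist_nonneg).1 le_rfl i

theorem isClosed_iInter_ker : IsClosed {b | ∀ i, ρ i b = 0} := by
  rw [Set.ofPred_forall]
  refine isClosed_iInter fun i => isClosed_eq ?_ continuous_const
  exact AddMonoidHomClass.continuous_of_bound (ρ i) 1 fun a => by
    simpa using NonUnitalStarAlgHom.norm_apply_le (ρ i) a

end Family

/-- The quotient of a C⋆-algebra by the joint kernel of a family of ⋆-representations is a
C⋆-algebra. -/
theorem exists_isQuotientCStarStructure {B ι : Type*} [NonUnitalRing B] [Module ℂ B]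
    {D : ι → Type} [∀ i, CStarAlgebra (D i)] (ρ : ∀ i, A →⋆ₙₐ[ℂ] D i) (φ : A →ₙₐ[ℂ] B)
    (hker : ∀ a, φ a = 0 ↔ ∀ i, ρ i a = 0) :
    ∃ S : NonUnitalCStarAlgebra (KernelQuotient φ), IsQuotientCStarStructure φ S := by
  have hstar : ∀ a, φ a = 0 → φ (star a) = 0 := fun a ha => by
    rw [hker] at ha ⊢
    exact fun i => (map_star_eq_zero_iff (ρ i) a).2 (ha i)
  have hset : {b | ∀ i, ρ i b = 0} = {b | φ b = 0} := Set.ext fun b => (hker b).symm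
  have hmul := infDist_iInter_ker_mul_le ρ
  have hcstar := infDist_iInter_ker_mul_self_le ρ
  have hclosed := isClosed_iInter_ker ρ
  rw [hset] at hmul hcstar hclosed
  clear hker hset
  let I : Submodule ℂ A := LinearMap.ker (φ : A →ₗ[ℂ] B)
  have hIc : IsClosed (I : Set A) := hclosed
  have hsurj : Function.Surjective (Submodule.Quotient.mk : A → A ⧸ I) :=
    Submodule.Quotient.mk_surjective I
  have heq : ∀ a b : A, (Submodule.Quotient.mk a : A ⧸ I) = Submodule.Quotient.mk b ↔
      φ (a - b) = 0 := fun a b => Submodule.Quotient.eq I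
  have hrel : ∀ a b : A, I.quotientRel.r a b ↔ φ (a - b) = 0 := fun a b => by
    rw [← heq]; exact Quotient.eq.symm
  have hnorm : ∀ a : A, ‖(Submodule.Quotient.mk a : A ⧸ I)‖ =
      Metric.infDist a {b : A | φ b = 0} := fun a => QuotientAddGroup.norm_mk a
  let instMul : Mul (A ⧸ I) := ⟨Quotient.map₂ (· * ·) fun a a' ha b b' hb => by
    have ha := (hrel _ _).1 ha
    have hb := (hrel _ _).1 hb
    refine (hrel _ _).2 ?_
    rw [map_sub, sub_eq_zero] at ha hb ⊢
    rw [map_mul, map_mul, ha, hb]⟩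
  let instStar : Star (A ⧸ I) := ⟨Quotient.map star fun a a' ha => by
    refine (hrel _ _).2 ?_
    rw [← star_sub]
    exact hstar _ ((hrel _ _).1 ha)⟩
  have mk_mul : ∀ a b : A, (Submodule.Quotient.mk (a * b) : A ⧸ I) =
      Submodule.Quotient.mk a * Submodule.Quotient.mk b := fun a b => rfl
  have mk_star : ∀ a : A, (Submodule.Quotient.mk (star a) : A ⧸ I) =
      star (Submodule.Quotient.mk a) := fun a => rfl
  let instRing : NonUnitalNormedRing (A ⧸ I) :=
    { (inferInstance : NormedAddCommGroup (A ⧸ I)), instMul with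
      left_distrib := by
        intro x y z
        obtain ⟨a, rfl⟩ := hsurj x
        obtain ⟨b, rfl⟩ := hsurj y
        obtain ⟨c, rfl⟩ := hsurj z
        rw [← Submodule.Quotient.mk_add, ← mk_mul, ← mk_mul, ← mk_mul, mul_add,
          Submodule.Quotient.mk_add]
      right_distrib := by
        intro x y z
        obtain ⟨a, rfl⟩ := hsurj x
        obtain ⟨b, rfl⟩ := hsurj y
        obtain ⟨c, rfl⟩ := hsurj z
        rw [← Submodule.Quotient.mk_add, ← mk_mul, ← mk_mul, ← mk_mul, add_mul,
          Submodule.Quotient.mk_add]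
      zero_mul := by
        intro x
        obtain ⟨a, rfl⟩ := hsurj x
        rw [← Submodule.Quotient.mk_zero, ← mk_mul, zero_mul]
      mul_zero := by
        intro x
        obtain ⟨a, rfl⟩ := hsurj x
        rw [← Submodule.Quotient.mk_zero, ← mk_mul, mul_zero]
      mul_assoc := by
        intro x y z
        obtain ⟨a, rfl⟩ := hsurj x
        obtain ⟨b, rfl⟩ := hsurj y
        obtain ⟨c, rfl⟩ := hsurj z
        rw [← mk_mul, ← mk_mul, ← mk_mul, ← mk_mul, mul_assoc]
      norm_mul_le := by
        intro x y
        obtain ⟨a, rfl⟩ := hsurj x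
        obtain ⟨b, rfl⟩ := hsurj y
        rw [← mk_mul, hnorm, hnorm, hnorm]
        exact hmul a b }
  let S : NonUnitalCStarAlgebra (A ⧸ I) :=
    { instRing, instStar, (inferInstance : NormedSpace ℂ (A ⧸ I)),
      (inferInstance : CompleteSpace (A ⧸ I)) with
      star_involutive := by
        intro x
        obtain ⟨a, rfl⟩ := hsurj x
        rw [← mk_star, ← mk_star, star_star]
      star_mul := by
        intro x y
        obtain ⟨a, rfl⟩ := hsurj x
        obtain ⟨b, rfl⟩ := hsurj y
        rw [← mk_star, ← mk_star, ← mk_mul, ← mk_mul, ← mk_star, star_mul]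
      star_add := by
        intro x y
        obtain ⟨a, rfl⟩ := hsurj x
        obtain ⟨b, rfl⟩ := hsurj y
        exact congrArg Submodule.Quotient.mk (star_add a b)
      norm_mul_self_le := by
        intro x
        obtain ⟨a, rfl⟩ := hsurj x
        rw [← mk_star, ← mk_mul, hnorm, hnorm]
        exact hcstar a
      smul_assoc := by
        intro c x y
        obtain ⟨a, rfl⟩ := hsurj x
        obtain ⟨b, rfl⟩ := hsurj y
        exact congrArg Submodule.Quotient.mk (smul_mul_assoc c a b)
      smul_comm := by
        intro c x y
        obtain ⟨a, rfl⟩ := hsurj x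
        obtain ⟨b, rfl⟩ := hsurj y
        exact congrArg Submodule.Quotient.mk (smul_comm c a b)
      star_smul := by
        intro c x
        obtain ⟨a, rfl⟩ := hsurj x
        exact congrArg Submodule.Quotient.mk (star_smul c a) }
  exact ⟨S, ⟨fun a b => rfl, fun a b => rfl, fun c a => rfl, fun a => rfl, hnorm⟩⟩

/-- A ⋆-homomorphism that vanishes on the kernel of `φ` factors through the quotient. -/
theorem IsQuotientCStarStructure.exists_lift {B D : Type*} [NonUnitalRing B] [Module ℂ B]
    [CStarAlgebra D] {φ : A →ₙₐ[ℂ] B} {S : NonUnitalCStarAlgebra (KernelQuotient φ)}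
    (hS : IsQuotientCStarStructure φ S) (ρ : A →⋆ₙₐ[ℂ] D) (hρ : ∀ c, φ c = 0 → ρ c = 0) :
    ∃ ρ' : KernelQuotient φ →⋆ₙₐ[ℂ] D, ∀ a, ρ' (KernelQuotient.mk φ a) = ρ a := by
  have hsurj : Function.Surjective (KernelQuotient.mk φ) :=
    Submodule.Quotient.mk_surjective _
  have hinv : ∀ a b, KernelQuotient.mk φ a = KernelQuotient.mk φ b → ρ a = ρ b := fun a b h => by
    rw [← sub_eq_zero, ← map_sub]
    exact hρ _ ((Submodule.Quotient.eq _).1 h)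
  let f : KernelQuotient φ → D := fun x => ρ (Function.surjInv hsurj x)
  have hf : ∀ a, f (KernelQuotient.mk φ a) = ρ a := fun a =>
    hinv _ _ (Function.surjInv_eq hsurj _)
  have hzero : KernelQuotient.mk φ 0 = 0 := by
    have := hS.mk_smul 0 0
    rwa [zero_smul, zero_smul] at this
  refine ⟨{ toFun := f
            map_smul' := ?_
            map_zero' := ?_
            map_add' := ?_
            map_mul' := ?_
            map_star' := ?_ }, hf⟩
  · intro c x
    obtain ⟨a, rfl⟩ := hsurj x
    rw [← hS.mk_smul, hf, hf, map_smul]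
    rfl
  · rw [← hzero, hf, map_zero]
  · intro x y
    obtain ⟨a, rfl⟩ := hsurj x
    obtain ⟨b, rfl⟩ := hsurj y
    rw [← hS.mk_add, hf, hf, hf, map_add]
  · intro x y
    obtain ⟨a, rfl⟩ := hsurj x
    obtain ⟨b, rfl⟩ := hsurj y
    rw [← hS.mk_mul, hf, hf, hf, map_mul]
  · intro x
    obtain ⟨a, rfl⟩ := hsurj x
    rw [← hS.mk_star, hf, hf, map_star]

/-- If finite dimensional representations that vanish on `ker φ` detect every element outside of
`ker φ`, then `A / ker φ` is a residually finite dimensional C⋆-algebra. -/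
theorem exists_isResiduallyFiniteDimensional_kernelQuotient {B : Type*} [NonUnitalRing B]
    [Module ℂ B] (φ : A →ₙₐ[ℂ] B)
    (hφ : ∀ a, φ a ≠ 0 → ∃ (n : ℕ)
      (ρ : A →⋆ₙₐ[ℂ] (EuclideanSpace ℂ (Fin n) →L[ℂ] EuclideanSpace ℂ (Fin n))),
      ρ a ≠ 0 ∧ ∀ c, φ c = 0 → ρ c = 0) :
    ∃ S : NonUnitalCStarAlgebra (KernelQuotient φ),
      IsQuotientCStarStructure φ S ∧ @IsResiduallyFiniteDimensional (KernelQuotient φ) S := by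
  choose n ρ hρ hρφ using hφ
  obtain ⟨S, hS⟩ := exists_isQuotientCStarStructure
    (D := fun a : {a // φ a ≠ 0} =>
      EuclideanSpace ℂ (Fin (n a a.2)) →L[ℂ] EuclideanSpace ℂ (Fin (n a a.2)))
    (fun a => ρ a a.2) φ (fun a => ⟨fun ha i => hρφ i i.2 a ha, fun h => by
      by_contra ha
      exact hρ a ha (h ⟨a, ha⟩)⟩)
  refine ⟨S, hS, fun x hx => ?_⟩
  obtain ⟨a, rfl⟩ : ∃ a, KernelQuotient.mk φ a = x := Submodule.Quotient.mk_surjective _ x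
  have ha : φ a ≠ 0 := fun h => hx (by
    have h0 : KernelQuotient.mk φ a = KernelQuotient.mk φ 0 :=
      (Submodule.Quotient.eq _).2 (by rw [sub_zero]; exact h)
    have := hS.mk_smul 0 0
    rw [zero_smul, zero_smul] at this
    rw [h0, this])
  obtain ⟨ρ', hρ'⟩ := hS.exists_lift (ρ a ha) (hρφ a ha)
  exact ⟨n a ha, ρ', by rw [hρ']; exact hρ a ha⟩

end Quotient

/-! ### Rademacher sums as finite lists. -/

section SignedSums

/-- The list of all sums `± b₁ ± b₂ ± ⋯ ± bₙ`. -/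
def signedSums {E : Type*} [AddCommGroup E] : List E → List E
  | [] => [0]
  | b :: l => (signedSums l).map (· + b) ++ (signedSums l).map (· - b)

variable {E V : Type*} [AddCommGroup E]

theorem sum_map_signedSums_cons [AddCommMonoid V] (F : E → V) (b : E) (l : List E) :
    ((signedSums (b :: l)).map F).sum =
      ((signedSums l).map fun s => F (s + b) + F (s - b)).sum := by
  rw [List.sum_map_add]
  simp [signedSums, Function.comp_def]

theorem length_signedSums (l : List E) : (signedSums l).length = 2 ^ l.length := by
  induction l with
  | nil => rfl
  | cons b l ih => simp [signedSums, ih, pow_succ, mul_two]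

theorem signedSums_map [AddCommGroup V] (u : E →+ V) (l : List E) :
    signedSums (l.map u) = (signedSums l).map u := by
  induction l with
  | nil => simp [signedSums]
  | cons b l ih => simp [signedSums, ih, Function.comp_def]

end SignedSums

/-! ### Random sums of self-adjoint elements and the little Grothendieck inequality. -/

section SelfAdjoint

variable {A : Type*} [NonUnitalCStarAlgebra A]

/-- The sum of the squares of the members of a list of self-adjoint elements. -/
def sumSq (l : List (selfAdjoint A)) : A := (l.map fun b : selfAdjoint A => (b * b : A)).sum

/-- The sum `∑ b x b` over the members `b` of a list of self-adjoint elements. -/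
def sumConj (x : A) (l : List (selfAdjoint A)) : A :=
  (l.map fun b : selfAdjoint A => (b * x * b : A)).sum

@[simp] theorem sumSq_nil : sumSq ([] : List (selfAdjoint A)) = 0 := rfl

@[simp] theorem sumSq_cons (b : selfAdjoint A) (l : List (selfAdjoint A)) :
    sumSq (b :: l) = b * b + sumSq l := by simp [sumSq]

@[simp] theorem sumConj_nil (x : A) : sumConj x ([] : List (selfAdjoint A)) = 0 := rfl

@[simp] theorem sumConj_cons (x : A) (b : selfAdjoint A) (l : List (selfAdjoint A)) :
    sumConj x (b :: l) = b * x * b + sumConj x l := by simp [sumConj]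

theorem sumConj_add (x y : A) (l : List (selfAdjoint A)) :
    sumConj (x + y) l = sumConj x l + sumConj y l := by
  induction l with
  | nil => simp
  | cons b l ih => rw [sumConj_cons, ih, sumConj_cons, sumConj_cons]; noncomm_ring

theorem isSelfAdjoint_sumSq (l : List (selfAdjoint A)) : IsSelfAdjoint (sumSq l) := by
  induction l with
  | nil => simp
  | cons b l ih =>
    rw [sumSq_cons]
    refine IsSelfAdjoint.add ?_ ih
    rw [IsSelfAdjoint, star_mul, b.2.star_eq]

/-- The element `s ^ 4`, in an algebra that need not be unital. -/
def fourthPower (s : selfAdjoint A) : A := s * s * (s * s)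

/-- Averaging over signs, for a function that transforms as a polynomial of degree two. -/
theorem sum_map_signedSums_of_parallelogram {G : selfAdjoint A → A} (h0 : G 0 = 0)
    (h : ∀ s b, G (s + b) + G (s - b) = 2 • G s + 2 • G b) (l : List (selfAdjoint A)) :
    ((signedSums l).map G).sum = 2 ^ l.length • (l.map G).sum := by
  induction l with
  | nil => simp [signedSums, h0]
  | cons b l ih =>
    have h' : (fun s => G (s + b) + G (s - b)) = fun s => 2 • G s + 2 • G b :=
      funext fun s => h s b
    have hs : ∀ l' : List (selfAdjoint A),
        (l'.map fun s => 2 • G s).sum = 2 • (l'.map G).sum := fun l' => by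
      rw [List.smul_sum, List.map_map]; rfl
    rw [sum_map_signedSums_cons, h', List.sum_map_add, hs, ih, List.map_const',
      List.sum_replicate, length_signedSums, List.map_cons, List.sum_cons, List.length_cons,
      pow_succ, mul_smul, smul_add, smul_add, smul_comm (2 ^ l.length) 2,
      smul_comm (2 ^ l.length) 2, add_comm]

theorem sumSq_signedSums (l : List (selfAdjoint A)) :
    sumSq (signedSums l) = 2 ^ l.length • sumSq l := by
  refine sum_map_signedSums_of_parallelogram (by simp) (fun s b => ?_) l
  push_cast
  noncomm_ring

theorem sumConj_signedSums (x : A) (l : List (selfAdjoint A)) :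
    sumConj x (signedSums l) = 2 ^ l.length • sumConj x l := by
  refine sum_map_signedSums_of_parallelogram (by simp) (fun s b => ?_) l
  push_cast
  noncomm_ring

section Order

variable [PartialOrder A] [StarOrderedRing A]

theorem selfAdjoint_mul_self_nonneg (b : selfAdjoint A) : 0 ≤ (b * b : A) := by
  simpa [b.2.star_eq] using star_mul_self_nonneg (b : A)

theorem selfAdjoint_conjugate_nonneg (b : selfAdjoint A) {x : A} (hx : 0 ≤ x) :
    0 ≤ (b * x * b : A) := by
  simpa [b.2.star_eq] using star_left_conjugate_nonneg hx (b : A)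

theorem sumSq_nonneg (l : List (selfAdjoint A)) : 0 ≤ sumSq l := by
  induction l with
  | nil => simp
  | cons b l ih => rw [sumSq_cons]; exact add_nonneg (selfAdjoint_mul_self_nonneg b) ih

theorem sumConj_nonneg {x : A} (hx : 0 ≤ x) (l : List (selfAdjoint A)) : 0 ≤ sumConj x l := by
  induction l with
  | nil => simp
  | cons b l ih => rw [sumConj_cons]; exact add_nonneg (selfAdjoint_conjugate_nonneg b hx) ih

theorem sumConj_le {x : A} (hx : IsSelfAdjoint x) (l : List (selfAdjoint A)) :
    sumConj x l ≤ ‖x‖ • sumSq l := by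
  induction l with
  | nil => simp
  | cons b l ih =>
    rw [sumConj_cons, sumSq_cons, smul_add]
    refine add_le_add ?_ ih
    simpa [b.2.star_eq] using CStarAlgebra.star_left_conjugate_le_norm_smul (a := (b : A)) hx

/-- The two sides differ by twice `|s * b - b * s|²`. This trades the sign-indefinite terms `s b s b
+ b s b s` for `s b² s + b s² b`, which can be estimated in the order. -/
theorem fourthPower_add_add_sub_le (s b : selfAdjoint A) :
    fourthPower (s + b) + fourthPower (s - b) ≤
      2 • (fourthPower s + fourthPower b + (s * s * (b * b) + b * b * (s * s)) +
        2 • (s * (b * b) * s) + 2 • (b * (s * s) * b)) := by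
  have h : 0 ≤ star (s * b - b * s : A) * (s * b - b * s) := star_mul_self_nonneg _
  rw [star_sub, star_mul, star_mul, s.2.star_eq, b.2.star_eq] at h
  rw [← sub_nonneg]
  have : 0 ≤ 2 • ((b * s - s * b) * (s * b - b * s) : A) := nsmul_nonneg h 2
  convert this using 1
  simp only [fourthPower]
  push_cast
  noncomm_ring

theorem sum_map_signedSums_fourthPower_le (l : List (selfAdjoint A)) :
    ((signedSums l).map fourthPower).sum ≤
      2 ^ l.length • (sumSq l * sumSq l + 2 • sumConj (sumSq l) l) := by
  induction l with
  | nil => simp [signedSums, fourthPower]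
  | cons b l ih =>
    rw [sum_map_signedSums_cons]
    refine (List.sum_le_sum fun s _ => fourthPower_add_add_sub_le s b).trans ?_
    have h1 : ∀ L : List (selfAdjoint A), (L.map fun s : selfAdjoint A =>
        2 • (fourthPower s + fourthPower b + (s * s * (b * b) + b * b * (s * s)) +
        2 • (s * (b * b) * s) + 2 • (b * (s * s) * b) : A)).sum =
        2 • ((L.map fourthPower).sum + L.length • fourthPower b +
          (sumSq L * (b * b) + b * b * sumSq L) +
          2 • sumConj (b * b : A) L + 2 • (b * sumSq L * b)) := fun L => by
      induction L with
      | nil => simp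
      | cons s L ih =>
        rw [List.map_cons, List.sum_cons, ih, List.map_cons, List.sum_cons, sumConj_cons,
          sumSq_cons, List.length_cons, add_smul, one_smul]
        noncomm_ring
    rw [h1, sumSq_signedSums, sumConj_signedSums, length_signedSums, List.length_cons, pow_succ',
      mul_smul]
    refine nsmul_le_nsmul_right ?_ 2
    -- The right-hand side also contains `2 b b² b`, the conjugate of the new square by `b` itself.
    -- The induction does not need this positive term.
    have h2 : 0 ≤ 2 ^ l.length • (2 • fourthPower b) :=
      nsmul_nonneg (nsmul_nonneg (by
        simpa [fourthPower, mul_assoc] using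
          selfAdjoint_conjugate_nonneg b (selfAdjoint_mul_self_nonneg b)) 2) _
    have h3 : 2 ^ l.length • (sumSq (b :: l) * sumSq (b :: l) +
        2 • sumConj (sumSq (b :: l)) (b :: l)) =
        2 ^ l.length • (sumSq l * sumSq l + 2 • sumConj (sumSq l) l) +
        2 ^ l.length • (fourthPower b + (sumSq l * (b * b) + b * b * sumSq l) +
          2 • sumConj (b * b : A) l + 2 • (b * sumSq l * b)) +
        2 ^ l.length • (2 • fourthPower b) := by
      rw [← smul_add, ← smul_add, sumConj_cons, sumSq_cons, sumConj_add]
      congr 1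
      simp only [fourthPower]
      noncomm_ring
    rw [h3]
    refine le_trans ?_ (le_add_of_nonneg_right h2)
    refine le_trans (le_of_eq ?_) (add_le_add_left ih _)
    simp only [smul_add, smul_mul_assoc, mul_smul_comm, smul_comm (2 ^ l.length) 2]
    abel

end Order

/-- The fourth moment of a random sum of self-adjoint elements is controlled by the sum of their
squares. -/
theorem norm_sum_map_signedSums_fourthPower_le (l : List (selfAdjoint A)) :
    ‖((signedSums l).map fourthPower).sum‖ ≤ 2 ^ l.length * (3 * ‖sumSq l‖ ^ 2) := by
  let _ := CStarAlgebra.spectralOrder A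
  let _ := CStarAlgebra.spectralOrderedRing A
  have h0 : 0 ≤ ((signedSums l).map fourthPower).sum := by
    refine List.sum_nonneg fun x hx => ?_
    obtain ⟨s, -, rfl⟩ := List.mem_map.1 hx
    simpa [fourthPower, mul_assoc] using
      selfAdjoint_conjugate_nonneg s (selfAdjoint_mul_self_nonneg s)
  refine (CStarAlgebra.norm_le_norm_of_nonneg_of_le h0
    (sum_map_signedSums_fourthPower_le l)).trans ?_
  have h1 : ‖sumConj (sumSq l) l‖ ≤ ‖sumSq l‖ * ‖sumSq l‖ := by
    refine (CStarAlgebra.norm_le_norm_of_nonneg_of_le (sumConj_nonneg (sumSq_nonneg l) l)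
      (sumConj_le (isSelfAdjoint_sumSq l) l)).trans ?_
    rw [norm_smul, norm_norm]
  have h2 : ‖sumSq l * sumSq l + 2 • sumConj (sumSq l) l‖ ≤ 3 * ‖sumSq l‖ ^ 2 := by
    refine (norm_add_le _ _).trans ?_
    have h3 := norm_mul_le (sumSq l) (sumSq l)
    have h4 := norm_nsmul_le (n := 2) (a := sumConj (sumSq l) l)
    push_cast at h4
    nlinarith
  refine norm_nsmul_le.trans ?_
  push_cast
  gcongr

/-- Truncation of a self-adjoint element at level `t`. -/
theorem exists_truncation (s : selfAdjoint A) {t : ℝ} (ht : 0 < t) :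
    ∃ f g : selfAdjoint A, s = f + g ∧ ‖f‖ ≤ t ∧
      ∀ [PartialOrder A] [StarOrderedRing A],
        (g * g : A) ≤ (1 / (16 * t ^ 2) : ℝ) • fourthPower s := by
  have hs : IsSelfAdjoint (s : A) := s.2
  -- Clamping to `[-t, t]` leaves a remainder of modulus at most `x² / (4 t)`, because `(|x| - 2 t)²
  -- ≥ 0`. Squaring gives the constant `1 / (16 t²)`.
  let k : ℝ → ℝ := fun x => max (-t) (min t x)
  have hk : Continuous k := continuous_const.max (continuous_const.min continuous_id)
  have hk0 : k 0 = 0 := by simp [k, ht.le]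
  have hf : IsSelfAdjoint (cfcₙ k (s : A)) := cfcₙ_predicate k _
  refine ⟨⟨cfcₙ k (s : A), hf⟩, s - ⟨cfcₙ k (s : A), hf⟩, by abel, ?_, ?_⟩
  · refine norm_cfcₙ_le fun x _ => ?_
    rw [Real.norm_eq_abs, abs_le]
    exact ⟨le_max_left _ _, max_le (by linarith) (min_le_left _ _)⟩
  · intro _ _
    have hd : Continuous fun x => x - k x := continuous_id.sub hk
    have hsq : Continuous fun x : ℝ => x * x := continuous_id.mul continuous_id
    have h1 : (s : A) - cfcₙ k (s : A) = cfcₙ (fun x => x - k x) (s : A) := by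
      rw [cfcₙ_sub (fun x : ℝ => x) k (s : A) continuousOn_id rfl hk.continuousOn hk0,
        cfcₙ_id' ℝ (s : A) hs]
    have h2 : (s : A) * s = cfcₙ (fun x : ℝ => x * x) (s : A) := by
      rw [cfcₙ_mul (fun x : ℝ => x) (fun x => x) (s : A) continuousOn_id rfl continuousOn_id rfl,
        cfcₙ_id' ℝ (s : A) hs]
    have h3 : fourthPower s = cfcₙ (fun x : ℝ => x * x * (x * x)) (s : A) := by
      rw [cfcₙ_mul (fun x : ℝ => x * x) (fun x => x * x) (s : A) hsq.continuousOn (by simp)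
        hsq.continuousOn (by simp), ← h2, fourthPower]
    have hc : Continuous fun x : ℝ => (1 / (16 * t ^ 2) : ℝ) • (x * x * (x * x)) := by
      fun_prop
    push_cast
    rw [h1, h3, ← cfcₙ_mul (fun x => x - k x) (fun x => x - k x) (s : A) hd.continuousOn
      (by simp [hk0]) hd.continuousOn (by simp [hk0]),
      ← cfcₙ_smul (1 / (16 * t ^ 2) : ℝ) (fun x : ℝ => x * x * (x * x)) (s : A)
        (hsq.mul hsq).continuousOn (by simp)]
    refine cfcₙ_mono (fun x _ => ?_) (hd.mul hd).continuousOn hc.continuousOn (by simp [hk0])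
      (by simp)
    have h4 : |x - k x| ≤ x ^ 2 / (4 * t) := by
      rw [le_div_iff₀ (by positivity)]
      simp only [k]
      rcases le_total x (-t) with h | h
      · rw [min_eq_right (by linarith), max_eq_left h, abs_of_nonpos (by linarith)]
        nlinarith [sq_nonneg (x + 2 * t)]
      rcases le_total t x with h' | h'
      · rw [min_eq_left h', max_eq_right (by linarith), abs_of_nonneg (by linarith)]
        nlinarith [sq_nonneg (x - 2 * t)]
      · rw [min_eq_right h', max_eq_right h, sub_self, abs_zero, zero_mul]
        positivity
    have h5 := mul_self_le_mul_self (abs_nonneg _) h4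
    rw [abs_mul_abs_self] at h5
    refine h5.trans (le_of_eq ?_)
    rw [smul_eq_mul]
    field_simp
    ring

/-- Truncation of the signed sums of a list: the truncated parts are bounded, and the remainders
have a small sum of squares. -/
theorem exists_truncation_signedSums (l : List (selfAdjoint A)) {t : ℝ} (ht : 0 < t) :
    ∃ f g : selfAdjoint A → selfAdjoint A, (∀ s, s = f s + g s) ∧ (∀ s, ‖f s‖ ≤ t) ∧
      ‖sumSq ((signedSums l).map g)‖ ≤
        1 / (16 * t ^ 2) * (2 ^ l.length * (3 * ‖sumSq l‖ ^ 2)) := by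
  let _ := CStarAlgebra.spectralOrder A
  let _ := CStarAlgebra.spectralOrderedRing A
  choose f g hfg hf hg using fun s : selfAdjoint A => exists_truncation s ht
  refine ⟨f, g, hfg, hf, ?_⟩
  have h : ∀ L : List (selfAdjoint A),
      sumSq (L.map g) ≤ (1 / (16 * t ^ 2) : ℝ) • (L.map fourthPower).sum := fun L => by
    induction L with
    | nil => simp
    | cons s L ih =>
      rw [List.map_cons, List.map_cons, sumSq_cons, List.sum_cons, smul_add]
      exact add_le_add (hg s) ih
  refine (CStarAlgebra.norm_le_norm_of_nonneg_of_le (sumSq_nonneg _) (h _)).trans ?_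
  rw [norm_smul, Real.norm_of_nonneg (by positivity)]
  exact mul_le_mul_of_nonneg_left (norm_sum_map_signedSums_fourthPower_le l) (by positivity)

/-- A bounded linear map from a C⋆-algebra into a space of cotype 2 satisfies the inequality
`∑ ‖u b‖² ≤ K ‖∑ b²‖` on self-adjoint elements as soon as it does so for some constant, with a
constant `K` that depends only on the norm of `u` and the cotype constant. -/
theorem sum_norm_sq_le_of_cotype {Y : Type*} [NormedAddCommGroup Y] [NormedSpace ℝ Y]
    (u : selfAdjoint A →+ Y) {M C : ℝ} (hC : 0 < C) (hu : ∀ a, ‖u a‖ ≤ M * ‖a‖)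
    (hY : ∀ l : List Y, 2 ^ l.length * (l.map (‖·‖ ^ 2)).sum ≤
      C * ((signedSums l).map (‖·‖ ^ 2)).sum)
    (hK : ∃ K : ℝ, ∀ l : List (selfAdjoint A), (l.map (‖u ·‖ ^ 2)).sum ≤ K * ‖sumSq l‖)
    (l : List (selfAdjoint A)) : (l.map (‖u ·‖ ^ 2)).sum ≤ 3 * C ^ 2 * M ^ 2 * ‖sumSq l‖ := by
  -- Extrapolation: cotype reduces the claim to the signed sums, which are truncated at level `t`.
  -- The truncated parts are estimated by the norm bound on `u`, the remainders by the assumed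
  -- inequality with constant `K`.
  have step : ∀ K : ℝ, 0 ≤ K →
      (∀ l : List (selfAdjoint A), (l.map (‖u ·‖ ^ 2)).sum ≤ K * ‖sumSq l‖) →
      ∀ l : List (selfAdjoint A), (l.map (‖u ·‖ ^ 2)).sum ≤
        (3 / 2 * C ^ 2 * M ^ 2 + K / 2) * ‖sumSq l‖ := by
    intro K hK0 hK l
    rcases (norm_nonneg (sumSq l)).eq_or_lt with h0 | h0
    · have := hK l
      rwa [← h0, mul_zero] at this ⊢
    set D := ‖sumSq l‖
    -- The level `t² = 3 C D / 4` is chosen so that the remainders contribute exactly `K / 2`.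
    have ht : 0 < √(3 / 4 * C * D) := Real.sqrt_pos.2 (by positivity)
    have ht2 : √(3 / 4 * C * D) ^ 2 = 3 / 4 * C * D := Real.sq_sqrt (by positivity)
    obtain ⟨f, g, hfg, hf, hg⟩ := exists_truncation_signedSums l ht
    have h1 := hY (l.map u)
    rw [signedSums_map, List.length_map, List.map_map, List.map_map] at h1
    have h2 : ((signedSums l).map ((‖·‖ ^ 2) ∘ u)).sum ≤
        ((signedSums l).map fun s => 2 * (M ^ 2 * (3 / 4 * C * D)) + 2 * ‖u (g s)‖ ^ 2).sum := by
      refine List.sum_le_sum fun s _ => ?_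
      have h3 : ‖u s‖ ≤ ‖u (f s)‖ + ‖u (g s)‖ := by
        conv_lhs => rw [hfg s, map_add]
        exact norm_add_le _ _
      have h4 : ‖u (f s)‖ ^ 2 ≤ M ^ 2 * (3 / 4 * C * D) := by
        rw [← ht2, ← mul_pow]
        rcases le_or_gt 0 M with hM | hM
        · exact pow_le_pow_left₀ (norm_nonneg _)
            ((hu _).trans (mul_le_mul_of_nonneg_left (hf s) hM)) 2
        · have h5 : ‖u (f s)‖ = 0 := le_antisymm
            ((hu _).trans (mul_nonpos_of_nonpos_of_nonneg hM.le (norm_nonneg _))) (norm_nonneg _)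
          rw [h5, zero_pow two_ne_zero]
          positivity
      show ‖u s‖ ^ 2 ≤ _
      nlinarith [sq_nonneg (‖u (f s)‖ - ‖u (g s)‖), norm_nonneg (u s)]
    have h5 : ((signedSums l).map fun s => 2 * ‖u (g s)‖ ^ 2).sum ≤
        2 * (K * (1 / (16 * (3 / 4 * C * D)) * (2 ^ l.length * (3 * D ^ 2)))) := by
      rw [List.sum_map_mul_left]
      have h6 := hK ((signedSums l).map g)
      rw [List.map_map] at h6
      rw [ht2] at hg
      exact mul_le_mul_of_nonneg_left (h6.trans (mul_le_mul_of_nonneg_left hg hK0)) two_pos.le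
    rw [List.sum_map_add, List.map_const', List.sum_replicate, length_signedSums,
      nsmul_eq_mul] at h2
    have h7 : (0 : ℝ) < 2 ^ l.length := by positivity
    refine le_of_mul_le_mul_left (h1.trans ((mul_le_mul_of_nonneg_left
      (h2.trans (add_le_add_right h5 _)) hC.le).trans (le_of_eq ?_))) h7
    push_cast
    field_simp
    ring
  obtain ⟨K, hK⟩ := hK
  -- The map `K ↦ 3 / 2 * C ^ 2 * M ^ 2 + K / 2` contracts to its fixed point `3 * C ^ 2 * M ^ 2`,
  -- so the initial constant disappears in the limit.
  have hiter : ∀ n : ℕ, ∀ l : List (selfAdjoint A), (l.map (‖u ·‖ ^ 2)).sum ≤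
      (3 * C ^ 2 * M ^ 2 + |K| / 2 ^ n) * ‖sumSq l‖ := by
    intro n
    induction n with
    | zero =>
      intro l
      refine (hK l).trans (mul_le_mul_of_nonneg_right ?_ (norm_nonneg _))
      have : 0 ≤ 3 * C ^ 2 * M ^ 2 := by positivity
      simpa using (le_abs_self K).trans (le_add_of_nonneg_left this)
    | succ n ih =>
      intro l
      refine (step _ (by positivity) ih l).trans (le_of_eq ?_)
      rw [pow_succ]
      ring
  have hlim : Filter.Tendsto (fun n : ℕ => (3 * C ^ 2 * M ^ 2 + |K| / 2 ^ n) * ‖sumSq l‖)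
      Filter.atTop (nhds ((3 * C ^ 2 * M ^ 2 + 0) * ‖sumSq l‖)) := by
    refine Filter.Tendsto.mul_const _ (tendsto_const_nhds.add ?_)
    have := (tendsto_pow_atTop_nhds_zero_of_lt_one (r := (1 / 2 : ℝ)) (by norm_num)
      (by norm_num)).const_mul |K|
    rw [mul_zero] at this
    refine this.congr fun n => ?_
    rw [one_div, inv_pow, div_eq_mul_inv]
  rw [add_zero] at hlim
  exact ge_of_tendsto' hlim fun n => hiter n l

/-- The Cauchy–Schwarz inequality `∑ f(b)² ≤ M² ‖∑ b²‖` for a bounded real functional. -/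
theorem sum_sq_le_of_functional (f : selfAdjoint A →ₗ[ℝ] ℝ) {M : ℝ} (hf : ∀ a, |f a| ≤ M * ‖a‖)
    (l : List (selfAdjoint A)) : (l.map (f · ^ 2)).sum ≤ M ^ 2 * ‖sumSq l‖ := by
  let _ := CStarAlgebra.spectralOrder A
  let _ := CStarAlgebra.spectralOrderedRing A
  set c := (l.map (f · ^ 2)).sum with hc
  have hc0 : 0 ≤ c := List.sum_nonneg fun x hx => by
    obtain ⟨s, -, rfl⟩ := List.mem_map.1 hx
    positivity
  rcases hc0.eq_or_lt with h0 | h0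
  · rw [← h0]; positivity
  let S : selfAdjoint A := (l.map fun b => f b • b).sum
  have hfS : f S = c := by
    simp only [S, map_list_sum, List.map_map, hc]
    congr 2
    funext b
    simp [sq]
  -- This is the expansion of `∑ (b - f b • T)² ≥ 0`. With `T = c⁻¹ • S` it gives `S² ≤ c ∑ b²`, and
  -- `c = f S ≤ M ‖S‖` finishes.
  have key : ∀ (T : selfAdjoint A) (L : List (selfAdjoint A)), 0 ≤ sumSq L -
      (((L.map fun b => f b • b).sum : selfAdjoint A) * T +
        T * ((L.map fun b => f b • b).sum : selfAdjoint A) : A) +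
      (L.map (f · ^ 2)).sum • (T * T : A) := fun T L => by
    induction L with
    | nil => simp
    | cons b L ih =>
      have := add_nonneg ih (selfAdjoint_mul_self_nonneg (b - f b • T))
      refine this.trans (le_of_eq ?_)
      simp only [List.map_cons, List.sum_cons, sumSq_cons]
      push_cast
      simp only [sub_mul, mul_sub, smul_mul_assoc, mul_smul_comm, add_mul, mul_add, add_smul,
        smul_sub, smul_smul, sq]
      abel
  have h1 := key (c⁻¹ • S) l
  have h2 : (S * S : A) ≤ c • sumSq l := by
    rw [← hc] at h1
    have h3 := smul_nonneg hc0 h1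
    rw [← sub_nonneg]
    refine h3.trans (le_of_eq ?_)
    simp only [selfAdjoint.val_smul, mul_smul_comm, smul_mul_assoc, smul_add, smul_sub, smul_smul]
    have e1 : c * c⁻¹ = 1 := mul_inv_cancel₀ h0.ne'
    have e2 : c * (c * (c⁻¹ * c⁻¹)) = 1 := by field_simp
    rw [e1, e2]
    simp only [one_smul]
    change _ - ((S : A) * S + S * S) + (S * S : A) = _
    abel
  have h3 : ‖S‖ ^ 2 ≤ c * ‖sumSq l‖ := by
    have h4 := CStarAlgebra.norm_le_norm_of_nonneg_of_le (selfAdjoint_mul_self_nonneg S) h2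
    rw [norm_smul, Real.norm_of_nonneg hc0] at h4
    have h5 := CStarRing.norm_star_mul_self (x := (S : A))
    rw [S.2.star_eq] at h5
    rw [h5, ← sq] at h4
    exact h4
  have h4 : c ^ 2 ≤ M ^ 2 * ‖S‖ ^ 2 := by
    rw [← mul_pow, ← hfS]
    exact sq_le_sq.2 ((hf S).trans (le_abs_self _))
  refine le_of_mul_le_mul_left ?_ h0
  nlinarith [mul_le_mul_of_nonneg_left h3 (sq_nonneg M)]

end SelfAdjoint

/-! ### Khintchine's inequality from second and fourth moments. -/

section Khintchine

theorem sum_map_signedSums_norm_sq (l : List ℂ) :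
    ((signedSums l).map fun s => ‖s‖ ^ 2).sum = 2 ^ l.length * (l.map fun c => ‖c‖ ^ 2).sum := by
  induction l with
  | nil => simp [signedSums]
  | cons b l ih =>
    have h : (fun s : ℂ => ‖s + b‖ ^ 2 + ‖s - b‖ ^ 2) = fun s => 2 * ‖s‖ ^ 2 + 2 * ‖b‖ ^ 2 := by
      funext s
      have := parallelogram_law_with_norm ℝ s b
      linarith [this, sq ‖s + b‖, sq ‖s - b‖, sq ‖s‖, sq ‖b‖]
    rw [sum_map_signedSums_cons, h, List.sum_map_add, List.sum_map_mul_left, ih, List.map_const',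
      List.sum_replicate, length_signedSums, List.map_cons, List.sum_cons, List.length_cons,
      nsmul_eq_mul]
    push_cast
    ring

/-- The left side is `2 (|s|² + |b|²)² + 8 (Re (s * conj b))²`, and the real part is at most `|s|
|b|`. -/
theorem norm_add_pow_four_add_norm_sub_pow_four_le (s b : ℂ) :
    ‖s + b‖ ^ 4 + ‖s - b‖ ^ 4 ≤ 2 * ‖s‖ ^ 4 + 12 * (‖s‖ ^ 2 * ‖b‖ ^ 2) + 2 * ‖b‖ ^ 4 := by
  have h (z : ℂ) : ‖z‖ ^ 4 = (z.re ^ 2 + z.im ^ 2) ^ 2 := by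
    rw [← Complex.normSq_add_mul_I z.re z.im, Complex.re_add_im, Complex.normSq_eq_norm_sq]; ring
  have h' (z : ℂ) : ‖z‖ ^ 2 = z.re ^ 2 + z.im ^ 2 := by
    rw [← Complex.normSq_add_mul_I z.re z.im, Complex.re_add_im, Complex.normSq_eq_norm_sq]
  rw [h, h, h, h, h', h']
  simp only [Complex.add_re, Complex.add_im, Complex.sub_re, Complex.sub_im]
  nlinarith [sq_nonneg (s.re * b.im - s.im * b.re)]

theorem sum_map_signedSums_norm_pow_four_le (l : List ℂ) :
    ((signedSums l).map fun s => ‖s‖ ^ 4).sum ≤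
      2 ^ l.length * (3 * (l.map fun c => ‖c‖ ^ 2).sum ^ 2) := by
  induction l with
  | nil => simp [signedSums]
  | cons b l ih =>
    rw [sum_map_signedSums_cons]
    refine (List.sum_le_sum fun s _ => norm_add_pow_four_add_norm_sub_pow_four_le s b).trans ?_
    rw [List.sum_map_add, List.sum_map_add, List.sum_map_mul_left, List.sum_map_mul_left,
      List.sum_map_mul_right, sum_map_signedSums_norm_sq, List.map_const',
      List.sum_replicate, length_signedSums, List.map_cons, List.sum_cons, List.length_cons,
      nsmul_eq_mul]
    push_cast
    have : (0 : ℝ) ≤ 2 ^ l.length * ‖b‖ ^ 4 := by positivity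
    set V := (l.map fun c => ‖c‖ ^ 2).sum
    have e : 2 ^ (l.length + 1) * (3 * (‖b‖ ^ 2 + V) ^ 2) = 2 * (2 ^ l.length * (3 * V ^ 2)) +
        12 * (2 ^ l.length * V * ‖b‖ ^ 2) + 6 * (2 ^ l.length * ‖b‖ ^ 4) := by ring
    rw [e]
    linarith

/-- This bounds a `p`-th moment below by second and fourth moments. With `V` the sum of the `‖c‖²`,
and `x = ‖s‖ / √V`, the normalized averages are `1` and at most `3`, so `1 - 3 / 4` remains, whence
the factor `4` in Khintchine. -/
theorem sq_sub_pow_four_le_rpow {p x : ℝ} (hp1 : 1 ≤ p) (hp2 : p ≤ 2) (hx : 0 ≤ x) :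
    x ^ 2 - x ^ 4 / 4 ≤ x ^ p := by
  rcases le_total x 1 with h | h
  · rcases hx.eq_or_lt with rfl | h0
    · simpa using Real.rpow_nonneg le_rfl p
    have := Real.rpow_le_rpow_of_exponent_ge h0 h hp2
    rw [Real.rpow_two] at this
    have : 0 ≤ x ^ 4 := by positivity
    linarith
  · have := Real.rpow_le_rpow_of_exponent_le h hp1
    rw [Real.rpow_one] at this
    have h2 : 0 ≤ x * (x ^ 3 - 4 * x + 4) := by
      refine mul_nonneg hx ?_
      nlinarith [mul_nonneg hx (sq_nonneg (x - 3 / 2)), sq_nonneg (x - 7 / 6)]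
    nlinarith

/-- The Khintchine inequality for `1 ≤ p ≤ 2`. -/
theorem rpow_le_sum_map_signedSums {p : ℝ} (hp1 : 1 ≤ p) (hp2 : p ≤ 2) (l : List ℂ) :
    2 ^ l.length * (l.map fun c => ‖c‖ ^ 2).sum ^ (p / 2) ≤
      4 * ((signedSums l).map fun s => ‖s‖ ^ p).sum := by
  set V := (l.map fun c => ‖c‖ ^ 2).sum with hV
  have hV0 : 0 ≤ V := List.sum_nonneg fun x hx => by
    obtain ⟨s, -, rfl⟩ := List.mem_map.1 hx
    positivity
  rcases hV0.eq_or_lt with h0 | h0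
  · rw [← h0, Real.zero_rpow (by positivity), mul_zero]
    refine mul_nonneg (by norm_num) (List.sum_nonneg fun x hx => ?_)
    obtain ⟨s, -, rfl⟩ := List.mem_map.1 hx
    positivity
  have hpt : ∀ s ∈ signedSums l, V ^ (p / 2) * (V⁻¹ * ‖s‖ ^ 2) -
      V ^ (p / 2) * (V⁻¹ ^ 2 / 4 * ‖s‖ ^ 4) ≤ ‖s‖ ^ p := fun s _ => by
    have h1 := sq_sub_pow_four_le_rpow hp1 hp2 (x := ‖s‖ / √V) (by positivity)
    have h2 : V ^ (p / 2) = √V ^ p := by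
      rw [Real.sqrt_eq_rpow, ← Real.rpow_mul hV0]
      ring_nf
    have h3 : (√V) ^ 2 = V := Real.sq_sqrt hV0
    have h4 : (√V) ^ 4 = V ^ 2 := by rw [show (√V) ^ 4 = ((√V) ^ 2) ^ 2 by ring, h3]
    have h5 : ‖s‖ ^ p = V ^ (p / 2) * (‖s‖ / √V) ^ p := by
      rw [Real.div_rpow (norm_nonneg _) (Real.sqrt_nonneg _), h2, mul_div_cancel₀]
      exact (Real.rpow_pos_of_pos (Real.sqrt_pos.2 h0) p).ne'
    rw [h5, ← mul_sub]
    refine mul_le_mul_of_nonneg_left (le_trans (le_of_eq ?_) h1) (by positivity)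
    rw [div_pow, div_pow, h3, h4]
    field_simp
  have h := List.sum_le_sum hpt
  have hsub : ((signedSums l).map fun s => V ^ (p / 2) * (V⁻¹ * ‖s‖ ^ 2) -
      V ^ (p / 2) * (V⁻¹ ^ 2 / 4 * ‖s‖ ^ 4)).sum =
      V ^ (p / 2) * (V⁻¹ * ((signedSums l).map fun s => ‖s‖ ^ 2).sum) -
      V ^ (p / 2) * (V⁻¹ ^ 2 / 4 * ((signedSums l).map fun s => ‖s‖ ^ 4).sum) := by
    induction signedSums l with
    | nil => simp
    | cons s L ih => simp only [List.map_cons, List.sum_cons, ih]; ring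
  rw [hsub, sum_map_signedSums_norm_sq, ← hV] at h
  have h4 := mul_le_mul_of_nonneg_left (mul_le_mul_of_nonneg_left
    (sum_map_signedSums_norm_pow_four_le l) (show 0 ≤ V⁻¹ ^ 2 / 4 by positivity))
    (show 0 ≤ V ^ (p / 2) by positivity)
  rw [← hV] at h4
  have e1 : V ^ (p / 2) * (V⁻¹ * (2 ^ l.length * V)) = 2 ^ l.length * V ^ (p / 2) := by
    field_simp
  have e2 : V ^ (p / 2) * (V⁻¹ ^ 2 / 4 * (2 ^ l.length * (3 * V ^ 2))) =
      3 / 4 * (2 ^ l.length * V ^ (p / 2)) := by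
    field_simp
  rw [e1] at h
  rw [e2] at h4
  linarith

end Khintchine

/-! ### Cotype 2 of finite dimensional `ℓᵖ` spaces for `p ≤ 2`, uniformly in the dimension. -/

section Cotype

/-- The triangle inequality in the two-dimensional `ℓ^r` space for the vectors `(a i, b i)`. -/
theorem rpow_add_rpow_le_sum {ι : Type*} {r : ℝ} (hr : 1 ≤ r) {a b : ι → ℝ} (ha : ∀ i, 0 ≤ a i)
    (hb : ∀ i, 0 ≤ b i) (s : Finset ι) :
    ((∑ i ∈ s, a i) ^ r + (∑ i ∈ s, b i) ^ r) ^ (1 / r) ≤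
      ∑ i ∈ s, (a i ^ r + b i ^ r) ^ (1 / r) := by
  classical
  induction s using Finset.induction_on with
  | empty =>
    have h1 : r ≠ 0 := by positivity
    simp [Real.zero_rpow h1, Real.zero_rpow (inv_ne_zero h1)]
  | insert i s hi ih =>
    rw [Finset.sum_insert hi, Finset.sum_insert hi, Finset.sum_insert hi]
    refine le_trans ?_ (add_le_add_right ih _)
    have hA := Finset.sum_nonneg fun i (_ : i ∈ s) => ha i
    have hB := Finset.sum_nonneg fun i (_ : i ∈ s) => hb i
    have := Real.Lp_add_le_of_nonneg (s := (Finset.univ : Finset (Fin 2)))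
      (f := ![a i, b i]) (g := ![∑ i ∈ s, a i, ∑ i ∈ s, b i]) hr
      (fun j _ => by fin_cases j <;> simp [ha, hb]) (fun j _ => by fin_cases j <;> simp [hA, hB])
    simpa using this

variable {ι : Type*} [Fintype ι] {p : ENNReal} [Fact (1 ≤ p)]

/-- The expression `∑ⱼ (∑ |yⱼ|²) ^ (p / 2)` for a list of vectors `y`, the `p`-th power of the norm
of their square function. -/
noncomputable def squareFunctionSum (l : List (PiLp p fun _ : ι => ℂ)) : ℝ :=
  ∑ j, (l.map fun y => ‖y j‖ ^ 2).sum ^ (p.toReal / 2)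

theorem PiLp.norm_rpow_eq_sum (hp : p ≠ ⊤) (y : PiLp p fun _ : ι => ℂ) :
    ‖y‖ ^ p.toReal = ∑ j, ‖y j‖ ^ p.toReal := by
  have hp0 : 0 < p.toReal := ENNReal.toReal_pos (zero_lt_one.trans_le Fact.out).ne' hp
  rw [PiLp.norm_eq_sum hp0, ← Real.rpow_mul (by positivity), one_div_mul_cancel hp0.ne',
    Real.rpow_one]

theorem list_sum_norm_sq_nonneg {E α : Type*} [NormedAddCommGroup E] (f : α → E) (l : List α) :
    0 ≤ (l.map fun y => ‖f y‖ ^ 2).sum := List.sum_nonneg fun x hx => by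
  obtain ⟨s, -, rfl⟩ := List.mem_map.1 hx
  positivity

/-- This is the 2-concavity of `ℓᵖ`, obtained by adding one vector at a time with Minkowski's
inequality for the exponent `2 / p`. -/
theorem sum_norm_sq_le_squareFunctionSum (hp : p ≤ 2) (l : List (PiLp p fun _ : ι => ℂ)) :
    (l.map fun y => ‖y‖ ^ 2).sum ≤ squareFunctionSum l ^ (2 / p.toReal) := by
  have hpt : p ≠ ⊤ := (hp.trans_lt (by norm_num)).ne
  have hp0 : 0 < p.toReal := ENNReal.toReal_pos (zero_lt_one.trans_le Fact.out).ne' hpt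
  have hp2 : p.toReal ≤ 2 := by
    simpa using ENNReal.toReal_mono (by norm_num) hp
  have hr : 1 ≤ 2 / p.toReal := by rwa [le_div_iff₀ hp0, one_mul]
  induction l with
  | nil => simpa [squareFunctionSum] using by positivity
  | cons y l ih =>
    rw [List.map_cons, List.sum_cons]
    have h := rpow_add_rpow_le_sum hr (a := fun j => ‖y j‖ ^ p.toReal)
      (b := fun j => (l.map fun y => ‖y j‖ ^ 2).sum ^ (p.toReal / 2))
      (fun j => by positivity) (fun j => by
        have := list_sum_norm_sq_nonneg (fun y : PiLp p fun _ : ι => ℂ => y j) l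
        positivity)
      Finset.univ
    have h1 : ∑ j, ((‖y j‖ ^ p.toReal) ^ (2 / p.toReal) +
        ((l.map fun y => ‖y j‖ ^ 2).sum ^ (p.toReal / 2)) ^ (2 / p.toReal)) ^
          (1 / (2 / p.toReal)) = squareFunctionSum (y :: l) := by
      refine Finset.sum_congr rfl fun j _ => ?_
      have hn := list_sum_norm_sq_nonneg (fun y : PiLp p fun _ : ι => ℂ => y j) l
      rw [← Real.rpow_mul (norm_nonneg _), ← Real.rpow_mul hn, mul_div_cancel₀ _ hp0.ne',
        show p.toReal / 2 * (2 / p.toReal) = 1 by field_simp, Real.rpow_one, Real.rpow_two,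
        one_div_div, List.map_cons, List.sum_cons]
    rw [h1, ← PiLp.norm_rpow_eq_sum hpt, ← Real.rpow_mul (norm_nonneg _),
      mul_div_cancel₀ _ hp0.ne', Real.rpow_two] at h
    have hn : 0 ≤ squareFunctionSum l := Finset.sum_nonneg fun j _ => by
      have := list_sum_norm_sq_nonneg (fun y : PiLp p fun _ : ι => ℂ => y j) l
      positivity
    refine (add_le_add_right ih _).trans ?_
    have h2 := Real.rpow_le_rpow (by positivity) h (show 0 ≤ 2 / p.toReal by positivity)
    rwa [← Real.rpow_mul (by positivity), one_div_mul_cancel (by positivity), Real.rpow_one] at h2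

theorem squareFunctionSum_le (hp : p ≤ 2) (l : List (PiLp p fun _ : ι => ℂ)) :
    2 ^ l.length * squareFunctionSum l ≤
      4 * ((signedSums l).map fun s => ‖s‖ ^ p.toReal).sum := by
  have hpt : p ≠ ⊤ := (hp.trans_lt (by norm_num)).ne
  have hp1 : 1 ≤ p.toReal := by
    simpa using ENNReal.toReal_mono hpt (Fact.out : 1 ≤ p)
  have hp2 : p.toReal ≤ 2 := by
    simpa using ENNReal.toReal_mono (by norm_num) hp
  have h : ((signedSums l).map fun s => ‖s‖ ^ p.toReal).sum =
      ∑ j, ((signedSums l).map fun s => ‖s j‖ ^ p.toReal).sum := by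
    induction signedSums l with
    | nil => simp
    | cons s L ih =>
      simp only [List.map_cons, List.sum_cons]
      rw [ih, PiLp.norm_rpow_eq_sum hpt, Finset.sum_add_distrib]
  rw [h, squareFunctionSum, Finset.mul_sum, Finset.mul_sum]
  refine Finset.sum_le_sum fun j _ => ?_
  let e : (PiLp p fun _ : ι => ℂ) →+ ℂ :=
    { toFun := fun y => y j
      map_zero' := rfl
      map_add' := fun _ _ => rfl }
  have := rpow_le_sum_map_signedSums hp1 hp2 (l.map e)
  rw [signedSums_map, List.map_map, List.map_map, List.length_map] at this
  exact this

/-- Each term satisfies `x ^ P ≤ lam ^ P + lam ^ (P - 2) * x ^ 2`, according to whether `x` is below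
or above `lam`. This replaces Hölder's inequality at the cost of a factor `2`. -/
theorem sum_rpow_le_of_sum_sq_le {P lam : ℝ} (hP : 0 ≤ P) (hP2 : P ≤ 2) (hl : 0 < lam) (L : List ℝ)
    (hL : ∀ x ∈ L, 0 ≤ x) (h : (L.map (· ^ 2)).sum ≤ L.length * lam ^ 2) :
    (L.map (· ^ P)).sum ≤ 2 * L.length * lam ^ P := by
  have h1 : ∀ x ∈ L, x ^ P ≤ lam ^ P + lam ^ P / lam ^ 2 * x ^ 2 := fun x hx => by
    rcases le_total x lam with h | h
    · exact (Real.rpow_le_rpow (hL x hx) h hP).trans (le_add_of_nonneg_right (by positivity))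
    · have h2 : (x / lam) ^ P ≤ (x / lam) ^ 2 := by
        rw [← Real.rpow_two]
        exact Real.rpow_le_rpow_of_exponent_le (by rwa [one_le_div hl]) hP2
      rw [Real.div_rpow (hL x hx) hl.le, div_pow, div_le_iff₀ (by positivity)] at h2
      refine (h2.trans (le_of_eq ?_)).trans (le_add_of_nonneg_left (by positivity))
      ring
  refine (List.sum_le_sum h1).trans ?_
  rw [List.sum_map_add, List.map_const', List.sum_replicate, List.sum_map_mul_left, nsmul_eq_mul]
  have := mul_le_mul_of_nonneg_left h (show 0 ≤ lam ^ P / lam ^ 2 by positivity)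
  refine (add_le_add_right this _).trans (le_of_eq ?_)
  field_simp
  ring

theorem squareFunctionSum_le_of_sum_sq_le (hp : p ≤ 2) (l : List (PiLp p fun _ : ι => ℂ)) {lam : ℝ}
    (hl : 0 < lam) (h : ((signedSums l).map fun s => ‖s‖ ^ 2).sum ≤ 2 ^ l.length * lam ^ 2) :
    squareFunctionSum l ≤ 8 * lam ^ p.toReal := by
  have hp2 : p.toReal ≤ 2 := by
    simpa using ENNReal.toReal_mono (by norm_num) hp
  have h1 := squareFunctionSum_le hp l
  have h2 := sum_rpow_le_of_sum_sq_le ENNReal.toReal_nonneg hp2 hl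
    ((signedSums l).map fun s => ‖s‖) (fun x hx => by
      obtain ⟨s, -, rfl⟩ := List.mem_map.1 hx
      positivity) (by
      rw [List.map_map, List.length_map, length_signedSums]
      push_cast
      exact h)
  rw [List.map_map, List.length_map, length_signedSums] at h2
  push_cast at h2
  have h3 : (0 : ℝ) < 2 ^ l.length := by positivity
  refine le_of_mul_le_mul_left (h1.trans ((mul_le_mul_of_nonneg_left h2 (by norm_num)).trans
    (le_of_eq ?_))) h3
  ring

/-- The spaces `ℓᵖ` with `p ≤ 2` have cotype 2. -/
theorem PiLp.cotype_two (hp : p ≤ 2) (l : List (PiLp p fun _ : ι => ℂ)) :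
    2 ^ l.length * (l.map (‖·‖ ^ 2)).sum ≤ 64 * ((signedSums l).map (‖·‖ ^ 2)).sum := by
  have hpt : p ≠ ⊤ := (hp.trans_lt (by norm_num)).ne
  have hp1 : 1 ≤ p.toReal := by
    simpa using ENNReal.toReal_mono hpt (Fact.out : 1 ≤ p)
  have h3 : (0 : ℝ) < 2 ^ l.length := by positivity
  have hS := list_sum_norm_sq_nonneg (fun s : PiLp p fun _ : ι => ℂ => s) (signedSums l)
  refine le_of_forall_pos_le_add fun ε hε => ?_
  set S := ((signedSums l).map fun s => ‖s‖ ^ 2).sum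
  -- The mean square of the signed sums, perturbed to be positive. The factor `64` comes from `8 ^
  -- (2 / p) ≤ 8 ^ 2`, since `p ≥ 1`.
  set m := (S + ε / 64) / 2 ^ l.length with hm
  have hm0 : 0 < m := by positivity
  have h := squareFunctionSum_le_of_sum_sq_le hp l (Real.sqrt_pos.2 hm0) (by
    rw [Real.sq_sqrt hm0.le, hm, mul_div_cancel₀ _ h3.ne']
    linarith)
  have hn : 0 ≤ squareFunctionSum l := Finset.sum_nonneg fun j _ => by
    have := list_sum_norm_sq_nonneg (fun y : PiLp p fun _ : ι => ℂ => y j) l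
    positivity
  have h1 := (sum_norm_sq_le_squareFunctionSum hp l).trans
    (Real.rpow_le_rpow hn h (show 0 ≤ 2 / p.toReal by positivity))
  rw [Real.mul_rpow (by norm_num) (by positivity), ← Real.rpow_mul (Real.sqrt_nonneg _),
    mul_div_cancel₀ _ (by positivity), Real.rpow_two, Real.sq_sqrt hm0.le] at h1
  have h8 : (8 : ℝ) ^ (2 / p.toReal) ≤ 8 ^ (2 : ℝ) :=
    Real.rpow_le_rpow_of_exponent_le (by norm_num)
      ((div_le_iff₀ (by positivity)).2 (by linarith))
  have h2 : (l.map fun y => ‖y‖ ^ 2).sum ≤ 64 * m := h1.trans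
    ((mul_le_mul_of_nonneg_right h8 hm0.le).trans (by norm_num))
  refine (mul_le_mul_of_nonneg_left h2 h3.le).trans (le_of_eq ?_)
  rw [hm]
  change _ = 64 * S + ε
  field_simp

end Cotype

/-! ### Compactness of bounded maps from C⋆-algebras into `ℓᵖ`, `p < 2`. -/

section CompactMap

open Set

variable {A : Type*} [NonUnitalCStarAlgebra A]

/-- The inequality `∑ ‖u b‖² ≤ K ‖∑ b²‖` holds, with some constant, for maps into finite
dimensional spaces. -/
theorem exists_sum_norm_sq_le_of_fintype {ι : Type*} [Fintype ι] {p : ENNReal} [Fact (1 ≤ p)]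
    (u : selfAdjoint A →ₗ[ℝ] PiLp p fun _ : ι => ℂ) {M : ℝ} (hu : ∀ a, ‖u a‖ ≤ M * ‖a‖) :
    ∃ K : ℝ, ∀ l : List (selfAdjoint A), (l.map (‖u ·‖ ^ 2)).sum ≤ K * ‖sumSq l‖ := by
  obtain ⟨c, hc0, hc⟩ : ∃ c : ℝ, 0 ≤ c ∧ ∀ y : PiLp p fun _ : ι => ℂ,
      ‖y‖ ^ 2 ≤ c * ∑ j, ‖y j‖ ^ 2 := by
    obtain ⟨c, hc⟩ : ∃ c : NNReal, AntilipschitzWith c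
        (WithLp.ofLp : PiLp p (fun _ : ι => ℂ) → ι → ℂ) :=
      ⟨_, PiLp.antilipschitzWith_ofLp p _⟩
    refine ⟨(c : ℝ) ^ 2, by positivity, fun y => ?_⟩
    have h1 : ‖y‖ ≤ c * ‖WithLp.ofLp y‖ := by
      have := hc.le_mul_dist y 0
      rwa [dist_zero_right, WithLp.ofLp_zero, dist_zero_right] at this
    have h2 : ‖WithLp.ofLp y‖ ≤ √(∑ j, ‖y j‖ ^ 2) := by
      refine (pi_norm_le_iff_of_nonneg (Real.sqrt_nonneg _)).2 fun j => Real.le_sqrt_of_sq_le ?_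
      exact Finset.single_le_sum (f := fun j => ‖y j‖ ^ 2) (fun j _ => by positivity)
        (Finset.mem_univ j)
    have h3 : √(∑ j, ‖y j‖ ^ 2) ^ 2 = ∑ j, ‖y j‖ ^ 2 := Real.sq_sqrt (by positivity)
    rw [← h3, ← mul_pow]
    exact pow_le_pow_left₀ (norm_nonneg _)
      (h1.trans (mul_le_mul_of_nonneg_left h2 c.2)) 2
  have hcoord : ∀ (j : ι) (l : List (selfAdjoint A)),
      (l.map fun b => ‖u b j‖ ^ 2).sum ≤ 2 * M ^ 2 * ‖sumSq l‖ := fun j l => by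
    let e : (PiLp p fun _ : ι => ℂ) →ₗ[ℝ] ℂ :=
      { toFun := fun y => y j
        map_smul' := fun _ _ => rfl
        map_add' := fun _ _ => rfl }
    have hj : ∀ a, ‖u a j‖ ≤ M * ‖a‖ := fun a => (PiLp.norm_apply_le (u a) j).trans (hu a)
    have h1 := sum_sq_le_of_functional (Complex.reLm ∘ₗ e ∘ₗ u)
      (fun a => (Complex.abs_re_le_norm _).trans (hj a)) l
    have h2 := sum_sq_le_of_functional (Complex.imLm ∘ₗ e ∘ₗ u)
      (fun a => (Complex.abs_im_le_norm _).trans (hj a)) l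
    have h3 : (l.map fun b => ‖u b j‖ ^ 2).sum =
        (l.map fun b => (Complex.reLm ∘ₗ e ∘ₗ u) b ^ 2).sum +
        (l.map fun b => (Complex.imLm ∘ₗ e ∘ₗ u) b ^ 2).sum := by
      rw [← List.sum_map_add]
      congr 2
      funext b
      rw [← Complex.normSq_eq_norm_sq, Complex.normSq_apply, sq, sq]
      rfl
    rw [h3]
    linarith
  -- The dependence on the dimension is harmless: this constant only starts the extrapolation in
  -- `sum_norm_sq_le_of_cotype`, which forgets it.
  refine ⟨c * (Fintype.card ι * (2 * M ^ 2)), fun l => ?_⟩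
  have h1 : (l.map (‖u ·‖ ^ 2)).sum ≤ c * ∑ j, (l.map fun b => ‖u b j‖ ^ 2).sum := by
    refine (List.sum_le_sum fun b _ => hc (u b)).trans (le_of_eq ?_)
    rw [List.sum_map_mul_left]
    congr 1
    induction l with
    | nil => simp
    | cons b l ih =>
      simp only [List.map_cons, List.sum_cons]
      rw [ih, Finset.sum_add_distrib]
  refine h1.trans ?_
  rw [mul_assoc]
  refine mul_le_mul_of_nonneg_left ?_ hc0
  refine (Finset.sum_le_sum fun j _ => hcoord j l).trans (le_of_eq ?_)
  rw [Finset.sum_const, Finset.card_univ, nsmul_eq_mul]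
  ring

variable {J : Type*} {p : ENNReal} [Fact (1 ≤ p)]

/-- The square function of the image of self-adjoint contractions under a bounded linear map into
`ℓᵖ` with `p ≤ 2`. -/
theorem sum_squareFunction_le (hp : p ≤ 2) (u : selfAdjoint A →ₗ[ℝ] lp (fun _ : J => ℂ) p) {M : ℝ}
    (hM : 0 < M) (hu : ∀ a, ‖u a‖ ≤ M * ‖a‖) (l : List (selfAdjoint A)) (hl : l ≠ [])
    (hl1 : ∀ a ∈ l, ‖a‖ ≤ 1) (F : Finset J) :
    ∑ j ∈ F, (l.map fun a => ‖(u a : J → ℂ) j‖ ^ 2).sum ^ (p.toReal / 2) ≤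
      8 * (√(3 * 64 ^ 2 * M ^ 2 * l.length)) ^ p.toReal := by
  have hpt : p ≠ ⊤ := (hp.trans_lt (by norm_num)).ne
  have hp0 : 0 < p.toReal := ENNReal.toReal_pos (zero_lt_one.trans_le Fact.out).ne' hpt
  let v : selfAdjoint A →ₗ[ℝ] PiLp p fun _ : F => ℂ :=
    { toFun := fun a => WithLp.toLp p fun j : F => (u a : J → ℂ) j
      map_smul' := fun c a => by rw [map_smul]; rfl
      map_add' := fun a b => by rw [map_add]; rfl }
  have hv : ∀ a, ‖v a‖ ≤ M * ‖a‖ := fun a => by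
    refine le_trans ?_ (hu a)
    rw [← Real.rpow_le_rpow_iff (norm_nonneg _) (norm_nonneg _) hp0, PiLp.norm_rpow_eq_sum hpt]
    refine le_trans (le_of_eq ?_) (lp.sum_rpow_le_norm_rpow hp0 (u a) F)
    exact F.sum_coe_sort fun j => ‖(u a : J → ℂ) j‖ ^ p.toReal
  have hlen : 0 < l.length := List.length_pos_iff.2 hl
  -- The inequality is applied to the list of all signed sums, whose squares add up to `2 ^
  -- l.length` times those of `l`. This bounds the mean square of `‖v s‖` over the signs.
  have hmain := sum_norm_sq_le_of_cotype v.toAddMonoidHom (by norm_num : (0 : ℝ) < 64) hv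
    (PiLp.cotype_two hp) (exists_sum_norm_sq_le_of_fintype v hv) (signedSums l)
  have hsq : ‖sumSq l‖ ≤ l.length := by
    clear hmain hl hlen
    induction l with
    | nil => simp
    | cons b l ih =>
      rw [sumSq_cons, List.length_cons]
      have h1 : ‖(b : A)‖ ≤ 1 := hl1 b (by simp)
      have h2 := ih fun a ha => hl1 a (by simp [ha])
      have h3 : ‖(b * b : A)‖ ≤ 1 := (norm_mul_le _ _).trans (mul_le_one₀ h1 (norm_nonneg _) h1)
      refine (norm_add_le _ _).trans ?_
      push_cast
      linarith
  have h := squareFunctionSum_le_of_sum_sq_le hp (l.map v)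
    (lam := √(3 * 64 ^ 2 * M ^ 2 * l.length)) (Real.sqrt_pos.2 (by positivity)) (by
      rw [Real.sq_sqrt (by positivity), List.length_map]
      have e := signedSums_map v.toAddMonoidHom l
      change signedSums (l.map v) = _ at e
      rw [e, List.map_map]
      refine hmain.trans ?_
      rw [sumSq_signedSums]
      have h1 : ‖2 ^ l.length • sumSq l‖ ≤ 2 ^ l.length * l.length := by
        refine norm_nsmul_le.trans ?_
        push_cast
        gcongr
      refine (mul_le_mul_of_nonneg_left h1 (by positivity)).trans (le_of_eq ?_)
      ring)
  refine le_trans (le_of_eq ?_) h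
  rw [squareFunctionSum, ← F.sum_coe_sort]
  refine Finset.sum_congr rfl fun j _ => ?_
  rw [List.map_map]
  rfl

/-- The image of the unit ball under a bounded linear map into `ℓᵖ` with `p < 2` has uniformly small
tails. -/
theorem exists_finset_forall_sum_le (hp : p < 2) (u : selfAdjoint A →ₗ[ℝ] lp (fun _ : J => ℂ) p)
    {M : ℝ} (hM : 0 < M) (hu : ∀ a, ‖u a‖ ≤ M * ‖a‖) {ε : ℝ} (hε : 0 < ε) :
    ∃ F : Finset J, ∀ a, ‖a‖ ≤ 1 → ∀ G : Finset J, Disjoint F G →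
      ∑ j ∈ G, ‖(u a : J → ℂ) j‖ ^ p.toReal ≤ ε := by
  classical
  by_contra! hcon
  have hpt : p ≠ ⊤ := (hp.trans (by norm_num)).ne
  have hp0 : 0 < p.toReal := ENNReal.toReal_pos (zero_lt_one.trans_le Fact.out).ne' hpt
  have hp2 : p.toReal < 2 := by
    simpa using (ENNReal.toReal_lt_toReal hpt (by norm_num)).2 hp
  have hnn : ∀ (l : List (selfAdjoint A)) (j : J),
      0 ≤ (l.map fun a => ‖(u a : J → ℂ) j‖ ^ 2).sum := fun l j => list_sum_norm_sq_nonneg _ l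
  -- Each new contraction has mass at least `ε` on a block disjoint from the earlier ones, so the
  -- sum grows linearly in `n`, against the upper bound of order `n ^ (p / 2)`.
  have hbuild : ∀ n : ℕ, ∃ (l : List (selfAdjoint A)) (F : Finset J), l.length = n ∧
      (∀ a ∈ l, ‖a‖ ≤ 1) ∧
      n * ε ≤ ∑ j ∈ F, (l.map fun a => ‖(u a : J → ℂ) j‖ ^ 2).sum ^ (p.toReal / 2) := by
    intro n
    induction n with
    | zero => exact ⟨[], ∅, rfl, by simp, by simp⟩
    | succ n ih =>
      obtain ⟨l, F, hl, hl1, hF⟩ := ih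
      obtain ⟨a, ha, G, hFG, hG⟩ := hcon F
      refine ⟨a :: l, F ∪ G, by simp [hl], List.forall_mem_cons.2 ⟨ha, hl1⟩, ?_⟩
      rw [Finset.sum_union hFG]
      push_cast
      rw [add_mul, one_mul]
      refine add_le_add (hF.trans (Finset.sum_le_sum fun j _ => ?_))
        (hG.le.trans (Finset.sum_le_sum fun j _ => ?_))
      · refine Real.rpow_le_rpow (hnn l j) ?_ (by positivity)
        rw [List.map_cons, List.sum_cons]
        exact le_add_of_nonneg_left (by positivity)
      · have h1 : ‖(u a : J → ℂ) j‖ ^ p.toReal = (‖(u a : J → ℂ) j‖ ^ 2) ^ (p.toReal / 2) := by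
          rw [← Real.rpow_two, ← Real.rpow_mul (norm_nonneg _), mul_div_cancel₀ _ two_ne_zero]
        rw [h1]
        refine Real.rpow_le_rpow (by positivity) ?_ (by positivity)
        rw [List.map_cons, List.sum_cons]
        exact le_add_of_nonneg_right (hnn l j)
  set C : ℝ := 8 * √(3 * 64 ^ 2 * M ^ 2) ^ p.toReal with hC
  have hbound : ∀ n : ℕ, 0 < n → (n : ℝ) ^ (1 - p.toReal / 2) ≤ C / ε := by
    intro n hn
    obtain ⟨l, F, hl, hl1, hF⟩ := hbuild n
    have h := hF.trans (sum_squareFunction_le hp.le u hM hu l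
      (List.length_pos_iff.1 (hl ▸ hn)) hl1 F)
    have hn' : (0 : ℝ) < n := Nat.cast_pos.2 hn
    have h1 : √(n : ℝ) ^ p.toReal = (n : ℝ) ^ (p.toReal / 2) := by
      rw [Real.sqrt_eq_rpow, ← Real.rpow_mul hn'.le]
      ring_nf
    rw [hl, Real.sqrt_mul (by positivity), Real.mul_rpow (by positivity) (by positivity), h1,
      ← mul_assoc, ← hC] at h
    rw [Real.rpow_sub hn', Real.rpow_one, div_le_div_iff₀ (by positivity) hε]
    exact h
  have hlim : Filter.Tendsto (fun n : ℕ => (n : ℝ) ^ (1 - p.toReal / 2)) Filter.atTop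
      Filter.atTop :=
    (tendsto_rpow_atTop (by linarith)).comp tendsto_natCast_atTop_atTop
  obtain ⟨n, hn0, hn⟩ := ((Filter.eventually_gt_atTop 0).and
    (hlim.eventually_gt_atTop (C / ε))).exists
  exact (hbound n hn0).not_gt hn

/-- Every bounded real-linear map from the self-adjoint part of a C⋆-algebra into `ℓᵖ` with `p < 2`
is compact. -/
theorem totallyBounded_image_selfAdjoint (hp : p < 2)
    (u : selfAdjoint A →ₗ[ℝ] lp (fun _ : J => ℂ) p) {M : ℝ} (hM : 0 < M)
    (hu : ∀ a, ‖u a‖ ≤ M * ‖a‖) : TotallyBounded (u '' Metric.closedBall 0 1) := by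
  classical
  have hpt : p ≠ ⊤ := (hp.trans (by norm_num)).ne
  have hp0 : 0 < p.toReal := ENNReal.toReal_pos (zero_lt_one.trans_le Fact.out).ne' hpt
  rw [image_eq_range]
  refine totallyBounded_range_of_forall_exists fun ε hε => ?_
  obtain ⟨F, hF⟩ := exists_finset_forall_sum_le hp u hM hu
    (show 0 < (ε / 8) ^ p.toReal by positivity)
  obtain ⟨δ, hδ, hδε⟩ : ∃ δ : ℝ, 0 < δ ∧ F.card * δ ^ p.toReal ≤ (ε / 4) ^ p.toReal := by
    refine ⟨((ε / 4) ^ p.toReal / (F.card + 1)) ^ (1 / p.toReal), by positivity, ?_⟩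
    rw [← Real.rpow_mul (by positivity), one_div_mul_cancel hp0.ne', Real.rpow_one,
      mul_div_assoc', div_le_iff₀ (by positivity), mul_comm]
    gcongr
    linarith
  refine ⟨F.card, fun a i => (u a : J → ℂ) (F.equivFin.symm i), δ, hδ, ?_, fun a b hab => ?_⟩
  · refine Metric.isBounded_range_iff.2 ⟨2 * M, fun a b => ?_⟩
    refine (dist_pi_le_iff (by positivity)).2 fun i => ?_
    have hle : ∀ a : Metric.closedBall (0 : selfAdjoint A) 1,
        ‖(u a : J → ℂ) (F.equivFin.symm i)‖ ≤ M := fun a =>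
      (lp.norm_apply_le_norm (zero_lt_one.trans_le Fact.out).ne' (u a) _).trans ((hu a).trans
        (mul_le_of_le_one_right hM.le (mem_closedBall_zero_iff.1 a.2)))
    rw [dist_eq_norm, two_mul]
    exact (norm_sub_le _ _).trans (add_le_add (hle a) (hle b))
  -- Half the difference lies in the unit ball, which is why the tails were taken at `ε / 8` rather
  -- than `ε / 4`.
  · have hc : ‖(2⁻¹ : ℝ) • ((a : selfAdjoint A) - b)‖ ≤ 1 := by
      rw [norm_smul]
      have := (norm_sub_le (a : selfAdjoint A) b).trans (add_le_add
        (mem_closedBall_zero_iff.1 a.2) (mem_closedBall_zero_iff.1 b.2))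
      rw [Real.norm_of_nonneg (by norm_num)]
      linarith
    rw [dist_eq_norm, ← map_sub]
    have htail : ∀ G : Finset J, Disjoint F G →
        ∑ j ∈ G, ‖(u ((a : selfAdjoint A) - b) : J → ℂ) j‖ ^ p.toReal ≤ (ε / 4) ^ p.toReal := by
      intro G hG
      have h1 := hF _ hc G hG
      rw [map_smul] at h1
      have h2 : ∀ j, ‖((2⁻¹ : ℝ) • u ((a : selfAdjoint A) - b) : lp (fun _ : J => ℂ) p) j‖ ^
          p.toReal = (1 / 2) ^ p.toReal * ‖(u ((a : selfAdjoint A) - b) : J → ℂ) j‖ ^ p.toReal := fun j => by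
        rw [← Real.mul_rpow (by norm_num) (norm_nonneg _), lp.coeFn_smul, Pi.smul_apply, norm_smul]
        norm_num
      simp_rw [h2] at h1
      rw [← Finset.mul_sum, show ε / 8 = 1 / 2 * (ε / 4) by ring,
        Real.mul_rpow (by norm_num) (by positivity)] at h1
      exact le_of_mul_le_mul_left h1 (by positivity)
    have hfin : ∑ j ∈ F, ‖(u ((a : selfAdjoint A) - b) : J → ℂ) j‖ ^ p.toReal ≤
        (ε / 4) ^ p.toReal := by
      refine le_trans ?_ hδε
      rw [← nsmul_eq_mul]
      refine Finset.sum_le_card_nsmul _ _ _ fun j hj => ?_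
      refine Real.rpow_le_rpow (norm_nonneg _) ?_ hp0.le
      have := (dist_le_pi_dist _ _ (F.equivFin ⟨j, hj⟩)).trans hab.le
      simp only [dist_eq_norm, Equiv.symm_apply_apply] at this
      rwa [map_sub]
    have hle : ‖u ((a : selfAdjoint A) - b)‖ ≤ ε / 4 + ε / 4 := by
      refine lp.norm_le_of_forall_sum_le hp0 (by positivity) fun s => ?_
      have h1 : ∑ j ∈ s, ‖(u ((a : selfAdjoint A) - b) : J → ℂ) j‖ ^ p.toReal ≤
          (ε / 4) ^ p.toReal + (ε / 4) ^ p.toReal := by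
        rw [← Finset.sum_inter_add_sum_sdiff s F]
        refine add_le_add (le_trans ?_ hfin) (htail _ Finset.disjoint_sdiff)
        exact Finset.sum_le_sum_of_subset_of_nonneg Finset.inter_subset_right
          fun j _ _ => by positivity
      refine h1.trans (Real.add_rpow_le_rpow_add (by positivity) (by positivity) ?_)
      simpa using ENNReal.toReal_mono hpt (Fact.out : 1 ≤ p)
    linarith

/-- Every bounded linear map from a C⋆-algebra into `ℓᵖ` with `p < 2` is compact. -/
theorem totallyBounded_image_closedBall_of_lt_two (hp : p < 2)
    (u : A →ₗ[ℂ] lp (fun _ : J => ℂ) p) {M : ℝ} (hu : ∀ a, ‖u a‖ ≤ M * ‖a‖) :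
    TotallyBounded (u '' Metric.closedBall 0 1) := by
  let v : selfAdjoint A →ₗ[ℝ] lp (fun _ : J => ℂ) p :=
    { toFun := fun a => u a
      map_smul' := fun c a => by
        rw [selfAdjoint.val_smul, ← Complex.coe_smul, map_smul]
        rfl
      map_add' := fun a b => by rw [AddSubgroup.coe_add, map_add] }
  have hv := totallyBounded_image_selfAdjoint hp v (M := |M| + 1) (by positivity) fun a =>
    (hu a).trans (mul_le_mul_of_nonneg_right ((le_abs_self M).trans (by linarith)) (norm_nonneg _))
  have hv' : TotallyBounded ((fun y => Complex.I • y) '' (v '' Metric.closedBall 0 1)) :=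
    hv.image (uniformContinuous_const_smul Complex.I)
  refine (hv.add_set hv').subset ?_
  rintro _ ⟨a, ha, rfl⟩
  rw [mem_closedBall_zero_iff] at ha
  refine ⟨v (realPart a), ⟨_, ?_, rfl⟩, _, ⟨v (imaginaryPart a), ⟨_, ?_, rfl⟩, rfl⟩, ?_⟩
  · exact mem_closedBall_zero_iff.2 ((realPart.norm_le a).trans ha)
  · exact mem_closedBall_zero_iff.2 ((imaginaryPart.norm_le a).trans ha)
  · change u _ + Complex.I • u _ = _
    rw [← map_smul, ← map_add, realPart_add_I_smul_imaginaryPart]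

end CompactMap

/-! ### Clarkson's inequality and uniform convexity. -/

section Clarkson

theorem Real.add_rpow_add_rpow_le {P α β : ℝ} (hP : 1 ≤ P) (hα : 0 ≤ α) (hβ : 0 ≤ β) :
    (α + β) ^ P ≤ 2 ^ (P - 1) * (α ^ P + β ^ P) := by
  have := NNReal.rpow_add_le_mul_rpow_add_rpow ⟨α, hα⟩ ⟨β, hβ⟩ hP
  exact_mod_cast this

/-- The Clarkson inequality for complex numbers. -/
theorem Complex.norm_add_rpow_add_norm_sub_rpow_le {P : ℝ} (hP : 2 ≤ P) (a b : ℂ) :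
    ‖a + b‖ ^ P + ‖a - b‖ ^ P ≤ 2 ^ (P - 1) * (‖a‖ ^ P + ‖b‖ ^ P) := by
  have hsq : ∀ z : ℂ, ‖z‖ ^ P = (‖z‖ ^ 2) ^ (P / 2) := fun z => by
    rw [← Real.rpow_two, ← Real.rpow_mul (norm_nonneg _), mul_div_cancel₀ _ two_ne_zero]
  have h1 : 1 ≤ P / 2 := by linarith
  rw [hsq, hsq, hsq a, hsq b]
  have h2 := Real.add_rpow_le_rpow_add (sq_nonneg ‖a + b‖) (sq_nonneg ‖a - b‖) h1
  have h3 : ‖a + b‖ ^ 2 + ‖a - b‖ ^ 2 = 2 * (‖a‖ ^ 2 + ‖b‖ ^ 2) := by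
    have := parallelogram_law_with_norm ℝ a b
    linarith [sq ‖a + b‖, sq ‖a - b‖, sq ‖a‖, sq ‖b‖]
  have h4 := Real.add_rpow_add_rpow_le h1 (sq_nonneg ‖a‖) (sq_nonneg ‖b‖)
  rw [h3, Real.mul_rpow (by norm_num) (by positivity)] at h2
  refine h2.trans ((mul_le_mul_of_nonneg_left h4 (by positivity)).trans (le_of_eq ?_))
  rw [← mul_assoc, ← Real.rpow_add two_pos]
  ring_nf

variable {J : Type*} {p : ENNReal}

theorem lp.norm_add_rpow_add_norm_sub_rpow_le (hp : 2 ≤ p) (hpt : p ≠ ⊤)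
    (x y : lp (fun _ : J => ℂ) p) :
    ‖x + y‖ ^ p.toReal + ‖x - y‖ ^ p.toReal ≤
      2 ^ (p.toReal - 1) * (‖x‖ ^ p.toReal + ‖y‖ ^ p.toReal) := by
  have hp2 : 2 ≤ p.toReal := by simpa using ENNReal.toReal_mono hpt hp
  have hp0 : 0 < p.toReal := by linarith
  exact hasSum_le (fun j => Complex.norm_add_rpow_add_norm_sub_rpow_le hp2 (x j) (y j))
    ((lp.hasSum_norm hp0 (x + y)).add (lp.hasSum_norm hp0 (x - y)))
    (((lp.hasSum_norm hp0 x).add (lp.hasSum_norm hp0 y)).mul_left _)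

/-- The spaces `ℓᵖ` with `2 ≤ p < ∞` are uniformly convex. -/
theorem lp.uniformConvexSpace [Fact (1 ≤ p)] (hp : 2 ≤ p) (hpt : p ≠ ⊤) :
    UniformConvexSpace (lp (fun _ : J => ℂ) p) := by
  have hp2 : 2 ≤ p.toReal := by simpa using ENNReal.toReal_mono hpt hp
  have hp0 : 0 < p.toReal := by linarith
  refine ⟨fun ε hε => ?_⟩
  -- The maximum with `0` covers `ε > 2`, where the difference is negative and real powers
  -- misbehave.
  have hm : max 0 ((2 : ℝ) ^ p.toReal - ε ^ p.toReal) < 2 ^ p.toReal :=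
    max_lt (by positivity) (sub_lt_self _ (by positivity))
  refine ⟨2 - max 0 ((2 : ℝ) ^ p.toReal - ε ^ p.toReal) ^ (1 / p.toReal), ?_,
    fun x hx y hy hxy => ?_⟩
  · have := Real.rpow_lt_rpow (le_max_left _ _) hm (show 0 < 1 / p.toReal by positivity)
    rw [← Real.rpow_mul two_pos.le, mul_one_div_cancel hp0.ne', Real.rpow_one] at this
    linarith
  · rw [sub_sub_cancel]
    have h1 := lp.norm_add_rpow_add_norm_sub_rpow_le hp hpt x y
    rw [hx, hy, Real.one_rpow, one_add_one_eq_two, ← Real.rpow_add_one two_ne_zero,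
      sub_add_cancel] at h1
    have h2 := Real.rpow_le_rpow hε.le hxy hp0.le
    have h3 : ‖x + y‖ ^ p.toReal ≤ max 0 ((2 : ℝ) ^ p.toReal - ε ^ p.toReal) :=
      le_max_of_le_right (by linarith)
    have h4 := Real.rpow_le_rpow (by positivity) h3 (show 0 ≤ 1 / p.toReal by positivity)
    rwa [← Real.rpow_mul (norm_nonneg _), mul_one_div_cancel hp0.ne', Real.rpow_one] at h4

end Clarkson

/-! ### The dual of `ℓᵖ` inside `ℓ^q`. -/

section Dual

open Classical

variable {J : Type*} {p q : ENNReal} [Fact (1 ≤ p)]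

theorem sum_norm_single_rpow_le (hpq : p.toReal.HolderConjugate q.toReal)
    (f : StrongDual ℂ (lp (fun _ : J => ℂ) p)) (F : Finset J) :
    ∑ j ∈ F, ‖f (lp.single p j 1)‖ ^ q.toReal ≤ ‖f‖ ^ q.toReal := by
  set S := ∑ j ∈ F, ‖f (lp.single p j 1)‖ ^ q.toReal with hS
  have hS0 : 0 ≤ S := Finset.sum_nonneg fun j _ => by positivity
  rcases hS0.eq_or_lt with h0 | h0
  · rw [← h0]; positivity
  -- The extremal vector in Hölder's inequality: both `c j * f (e_j)` and `‖c j‖ ^ p` equal `‖f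
  -- (e_j)‖ ^ q`, where `e_j` is the `j`-th basis vector.
  let c : J → ℂ := fun j =>
    (starRingEnd ℂ) (f (lp.single p j 1)) * (‖f (lp.single p j 1)‖ ^ (q.toReal - 2) : ℝ)
  have hsingle : ∀ j, f (lp.single p j (c j)) =
      (‖f (lp.single p j 1)‖ ^ q.toReal : ℝ) := fun j => by
    have h1 : lp.single (E := fun _ : J => ℂ) p j (c j) = c j • lp.single p j 1 := by
      rw [← lp.single_smul, smul_eq_mul, mul_one]
    rw [h1, map_smul, smul_eq_mul]
    simp only [c]
    rw [mul_right_comm, mul_comm ((starRingEnd ℂ) _), Complex.mul_conj, Complex.normSq_eq_norm_sq,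
      ← Complex.ofReal_mul]
    congr 1
    rcases (norm_nonneg (f (lp.single p j 1))).eq_or_lt with h | h
    · rw [← h, Real.zero_rpow hpq.symm.ne_zero]; simp
    · rw [← Real.rpow_two, ← Real.rpow_add h]; ring_nf
  have hnormc : ∀ j, ‖c j‖ ^ p.toReal = ‖f (lp.single p j 1)‖ ^ q.toReal := fun j => by
    simp only [c]
    rw [norm_mul, RCLike.norm_conj, Complex.norm_real, Real.norm_of_nonneg (by positivity)]
    rcases (norm_nonneg (f (lp.single p j 1))).eq_or_lt with h | h
    · rw [← h, Real.zero_rpow hpq.symm.ne_zero, zero_mul, Real.zero_rpow hpq.ne_zero]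
    · have h1 : ‖f (lp.single p j 1)‖ * ‖f (lp.single p j 1)‖ ^ (q.toReal - 2) =
          ‖f (lp.single p j 1)‖ ^ (q.toReal - 1) := by
        rw [← Real.rpow_one_add' (norm_nonneg _) (by linarith [hpq.symm.lt])]
        ring_nf
      rw [h1, ← Real.rpow_mul (norm_nonneg _), hpq.symm.sub_one_mul_conj]
  have hx : ‖∑ j ∈ F, lp.single (E := fun _ : J => ℂ) p j (c j)‖ ^ p.toReal = S := by
    rw [lp.norm_sum_single hpq.pos, hS]
    exact Finset.sum_congr rfl fun j _ => hnormc j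
  have hfx : f (∑ j ∈ F, lp.single p j (c j)) = (S : ℂ) := by
    rw [map_sum, hS, Complex.ofReal_sum]
    exact Finset.sum_congr rfl fun j _ => hsingle j
  have h1 := f.le_opNorm (∑ j ∈ F, lp.single p j (c j))
  rw [hfx, Complex.norm_real, Real.norm_of_nonneg hS0] at h1
  have h2 : ‖∑ j ∈ F, lp.single (E := fun _ : J => ℂ) p j (c j)‖ = S ^ (1 / p.toReal) := by
    rw [← hx, ← Real.rpow_mul (norm_nonneg _), mul_one_div_cancel hpq.ne_zero, Real.rpow_one]
  rw [h2, ← div_le_iff₀ (by positivity)] at h1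
  have h3 : S / S ^ (1 / p.toReal) = S ^ (1 / q.toReal) := by
    have : 1 / q.toReal = 1 - 1 / p.toReal := by
      have := hpq.inv_add_inv_eq_one
      simp only [one_div]
      linarith
    rw [this, Real.rpow_sub h0, Real.rpow_one]
  rw [h3] at h1
  have h4 := Real.rpow_le_rpow (by positivity) h1 hpq.symm.nonneg
  rwa [← Real.rpow_mul hS0, one_div_mul_cancel hpq.symm.ne_zero, Real.rpow_one] at h4

/-- The dual of `ℓᵖ` embeds isometrically into `ℓ^q`, where `q` is the conjugate exponent. -/
theorem exists_isometry_dual_lp [Fact (1 ≤ q)] (hpq : p.toReal.HolderConjugate q.toReal) :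
    ∃ T : StrongDual ℂ (lp (fun _ : J => ℂ) p) →ₗ[ℂ] lp (fun _ : J => ℂ) q, ∀ f, ‖T f‖ = ‖f‖ := by
  have hpt : p ≠ ⊤ := fun h => by simpa [h] using hpq.pos
  let T : StrongDual ℂ (lp (fun _ : J => ℂ) p) →ₗ[ℂ] lp (fun _ : J => ℂ) q :=
    { toFun := fun f => ⟨fun j => f (lp.single p j 1), memℓp_gen' (sum_norm_single_rpow_le hpq f)⟩
      map_add' := fun f g => rfl
      map_smul' := fun c f => rfl }
  have hT : ∀ f j, T f j = f (lp.single p j 1) := fun f j => rfl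
  refine ⟨T, fun f => le_antisymm ?_ ?_⟩
  · exact lp.norm_le_of_forall_sum_le hpq.symm.pos (norm_nonneg _) (sum_norm_single_rpow_le hpq f)
  · refine f.opNorm_le_bound (norm_nonneg _) fun x => ?_
    have h1 : HasSum (fun j => f (lp.single p j (x j))) (f x) :=
      (lp.hasSum_single hpt x).mapL f
    have h2 : ∀ j, f (lp.single p j (x j)) = x j * T f j := fun j => by
      have h1 : lp.single (E := fun _ : J => ℂ) p j (x j) = x j • lp.single p j 1 := by
        rw [← lp.single_smul, smul_eq_mul, mul_one]
      rw [h1, map_smul, smul_eq_mul, hT]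
    have hsum := lp.summable_mul hpq.symm (T f) x
    have h3 := lp.tsum_mul_le_mul_norm' hpq.symm (T f) x
    refine le_trans ?_ h3
    rw [← h1.tsum_eq]
    have h4 : ∀ j, ‖f (lp.single p j (x j))‖ = ‖T f j‖ * ‖x j‖ := fun j => by
      rw [h2, norm_mul, mul_comm]
    refine (norm_tsum_le_tsum_norm ?_).trans (le_of_eq (tsum_congr h4))
    exact hsum.congr fun j => (h4 j).symm

end Dual

/-! ### From totally bounded dual orbits to totally bounded orbits. -/

section Orbit

open Set

/-- If a bounded group action on a uniformly convex space has totally bounded orbits on the dual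
space, then its orbits are totally bounded. -/
theorem totallyBounded_orbit_of_dual {E Γ : Type*} [NormedAddCommGroup E] [NormedSpace ℂ E]
    [UniformConvexSpace E] [Group Γ] (Φ : Γ →* (E →L[ℂ] E)) {C : ℝ} (hC : ∀ g, ‖Φ g‖ ≤ C)
    (hdual : ∀ y : StrongDual ℂ E, TotallyBounded (range fun g => y.comp (Φ g))) (x : E) :
    TotallyBounded (range fun g => Φ g x) := by
  let _ : NormedSpace ℝ E := NormedSpace.restrictScalars ℝ ℂ E
  have hC0 : 0 ≤ C := (norm_nonneg _).trans (hC 1)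
  have hinv : ∀ g z, Φ g (Φ g⁻¹ z) = z := fun g z => by
    rw [← mul_apply_eq_comp, ← map_mul, mul_inv_cancel, map_one]; rfl
  have hbdd : BddAbove (range fun g => ‖Φ g x‖) := by
    refine ⟨C * ‖x‖, ?_⟩
    rintro _ ⟨g, rfl⟩
    exact ((Φ g).le_opNorm x).trans (mul_le_mul_of_nonneg_right (hC g) (norm_nonneg _))
  set R := ⨆ g, ‖Φ g x‖ with hR
  have hle : ∀ g, ‖Φ g x‖ ≤ R := le_ciSup hbdd
  have hR0 : 0 ≤ R := (norm_nonneg _).trans (hle 1)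
  refine totallyBounded_range_iff.2 fun ε hε => ?_
  obtain ⟨δ, hδ, hconv⟩ := exists_forall_closed_ball_dist_add_le_two_mul_sub E
    (show 0 < ε / (C + 1) by positivity) R
  set η := δ / (2 * (R + 3)) with hη
  have hη0 : 0 < η := by positivity
  obtain ⟨g₀, hg₀⟩ := exists_lt_of_lt_ciSup (sub_lt_self R hη0)
  set z := Φ g₀ x with hz
  obtain ⟨y, hy1, hyz⟩ := exists_dual_vector'' ℂ z
  -- Here `z` nearly attains the largest norm `R` in the orbit and `y` norms `z`. If `w` almost
  -- fixes `y`, then `y (Φ w z + z)` is close to `2 R`, more than `2 R - δ`. Uniform convexity then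
  -- keeps `Φ w z` near `z`.
  have hnear : ∀ w, ‖y.comp (Φ w) - y‖ ≤ η → ‖Φ w z - z‖ < ε / (C + 1) := by
    intro w hw
    by_contra! hfar
    have hwz : ‖Φ w z‖ ≤ R := by
      have : Φ w z = Φ (w * g₀) x := by rw [map_mul]; rfl
      rw [this]
      exact hle _
    have h1 := hconv hwz (hle g₀) hfar
    have h2 : y (Φ w z + z) = (y.comp (Φ w) - y) z + 2 * (‖z‖ : ℂ) := by
      have : y z = (‖z‖ : ℂ) := hyz
      rw [map_add, sub_apply, this, ContinuousLinearMap.comp_apply]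
      ring
    have h3 : ‖(y.comp (Φ w) - y) z‖ ≤ η * R :=
      ((y.comp (Φ w) - y).le_opNorm z).trans (mul_le_mul hw (hle g₀) (norm_nonneg _) hη0.le)
    have h4 : 2 * ‖z‖ - η * R ≤ ‖y (Φ w z + z)‖ := by
      rw [h2]
      have h5 := norm_sub_le_norm_add (2 * (‖z‖ : ℂ)) ((y.comp (Φ w) - y) z)
      have h6 : ‖2 * (‖z‖ : ℂ)‖ = 2 * ‖z‖ := by simp
      rw [h6, add_comm] at h5
      linarith
    have h5 : ‖y (Φ w z + z)‖ ≤ ‖Φ w z + z‖ :=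
      (y.le_opNorm _).trans (mul_le_of_le_one_left (norm_nonneg _) hy1)
    have h6 : η * (2 * (R + 3)) = δ := div_mul_cancel₀ _ (by positivity)
    nlinarith
  obtain ⟨t, ht⟩ := totallyBounded_range_iff.1 (hdual y) (η / (C + 1)) (by positivity)
  classical
  -- When `g` approximates `g₀ * h⁻¹` on `y`, the element `w = g₀ * h⁻¹ * g⁻¹` almost fixes `y`.
  -- Applying `Φ (h * g₀⁻¹)` to `Φ w z ≈ z` gives `Φ (g⁻¹ * g₀) x ≈ Φ h x`.
  refine ⟨t.image fun g => g⁻¹ * g₀, fun h => ?_⟩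
  obtain ⟨g, hg, hhg⟩ := ht (g₀ * h⁻¹)
  refine ⟨g⁻¹ * g₀, Finset.mem_image_of_mem _ hg, ?_⟩
  have h1 : ‖y.comp (Φ (g₀ * h⁻¹ * g⁻¹)) - y‖ ≤ η := by
    have e : y.comp (Φ (g₀ * h⁻¹ * g⁻¹)) - y =
        (y.comp (Φ (g₀ * h⁻¹)) - y.comp (Φ g)).comp (Φ g⁻¹) := by
      ext v
      simp only [sub_apply, ContinuousLinearMap.comp_apply]
      rw [hinv, map_mul Φ (g₀ * h⁻¹)]
      rfl
    rw [e]
    rw [dist_eq_norm] at hhg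
    refine (ContinuousLinearMap.opNorm_comp_le _ _).trans ?_
    refine (mul_le_mul hhg.le (hC _) (norm_nonneg _) (by positivity)).trans ?_
    rw [div_mul_eq_mul_div, div_le_iff₀ (by positivity)]
    nlinarith
  have h2 := hnear _ h1
  have e : Φ h x - Φ (g⁻¹ * g₀) x = - Φ (h * g₀⁻¹) (Φ (g₀ * h⁻¹ * g⁻¹) z - z) := by
    have e1 : Φ (h * g₀⁻¹) (Φ (g₀ * h⁻¹ * g⁻¹) z) = Φ (g⁻¹ * g₀) x := by
      rw [hz, ← mul_apply_eq_comp, ← mul_apply_eq_comp, ← map_mul,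
        ← map_mul]
      congr 2
      group
    have e2 : Φ (h * g₀⁻¹) z = Φ h x := by
      rw [hz, ← mul_apply_eq_comp, ← map_mul, inv_mul_cancel_right]
    rw [map_sub, e1, e2, neg_sub]
  rw [dist_eq_norm, e, norm_neg]
  have h3 := ((Φ (h * g₀⁻¹)).le_opNorm (Φ (g₀ * h⁻¹ * g⁻¹) z - z)).trans
    (mul_le_mul_of_nonneg_right (hC _) (norm_nonneg _))
  rw [lt_div_iff₀ (by positivity)] at h2
  have := norm_nonneg (Φ (g₀ * h⁻¹ * g⁻¹) z - z)
  nlinarith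

end Orbit

/-! ### Compact orbits for homomorphisms, and the theorem. -/

section Homomorphism

open Set

variable {A : Type*} [NonUnitalCStarAlgebra A]

theorem TotallyBounded.smul_closedBall {V : Type*} [NormedAddCommGroup V] [NormedSpace ℂ V]
    [CompleteSpace V] {s : Set V} (hs : TotallyBounded s) :
    TotallyBounded ((fun x : ℂ × V => x.1 • x.2) '' (Metric.closedBall 0 1 ×ˢ s)) := by
  have hc : IsCompact (_root_.closure s) :=
    isCompact_iff_totallyBounded_isComplete.2 ⟨hs.closure, isClosed_closure.isComplete⟩
  have h := ((isCompact_closedBall (0 : ℂ) 1).prod hc).image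
    (continuous_fst.smul continuous_snd : Continuous fun x : ℂ × V => x.1 • x.2)
  exact h.totallyBounded.subset (image_mono (prod_mono subset_rfl subset_closure))

/-- A bounded homomorphism of a C⋆-algebra whose unitaries (in the unitization) have totally
bounded orbits maps the unit ball to totally bounded sets. -/
theorem totallyBounded_image_closedBall_of_unitary {E : Type*} [NormedAddCommGroup E]
    [NormedSpace ℂ E] [CompleteSpace E] (φ : A →ₙₐ[ℂ] (E →L[ℂ] E)) (x : E)
    (h : TotallyBounded (range fun u : unitary (Unitization ℂ A) =>
      NonUnitalAlgHom.toAlgHom φ (u : Unitization ℂ A) x)) :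
    TotallyBounded ((fun a => φ a x) '' Metric.closedBall 0 1) := by
  have h1 := h.smul_closedBall
  refine ((h1.add_set h1).add_set (h1.add_set h1)).subset ?_
  rintro _ ⟨a, ha, rfl⟩
  rw [mem_closedBall_zero_iff] at ha
  obtain ⟨u, c, hac, hc⟩ := CStarAlgebra.exists_sum_four_unitary (a : Unitization ℂ A)
  have hc1 : ∀ i, ‖c i‖ ≤ 1 := fun i => (hc i).trans (by
    rw [Unitization.norm_inr]
    linarith)
  have hmem : ∀ i, c i • NonUnitalAlgHom.toAlgHom φ (u i : Unitization ℂ A) x ∈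
      (fun x : ℂ × E => x.1 • x.2) '' (Metric.closedBall 0 1 ×ˢ
        range fun u : unitary (Unitization ℂ A) =>
          NonUnitalAlgHom.toAlgHom φ (u : Unitization ℂ A) x) := fun i =>
    ⟨(c i, _), ⟨mem_closedBall_zero_iff.2 (hc1 i), u i, rfl⟩, rfl⟩
  have hφa : φ a x = NonUnitalAlgHom.toAlgHom φ (a : Unitization ℂ A) x := by simp
  change φ a x ∈ _
  rw [hφa, hac, Fin.sum_univ_four, add_assoc (_ + _)]
  simp only [map_add, map_smul]
  exact add_mem_add (add_mem_add (hmem 0) (hmem 1)) (add_mem_add (hmem 2) (hmem 3))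

variable {J : Type*} {p : ENNReal} [Fact (1 ≤ p)]

/-- The orbits of the unit ball of a C⋆-algebra under a bounded homomorphism into the operators on
`ℓᵖ` are totally bounded, for `2 < p < ∞`. -/
theorem totallyBounded_image_closedBall_of_two_lt (hp : 2 < p) (hpt : p ≠ ⊤)
    (φ : A →ₙₐ[ℂ] (lp (fun _ : J => ℂ) p →L[ℂ] lp (fun _ : J => ℂ) p))
    (hφ : ∃ C : ℝ, ∀ a, ‖φ a‖ ≤ C * ‖a‖) (x : lp (fun _ : J => ℂ) p) :
    TotallyBounded ((fun a => φ a x) '' Metric.closedBall 0 1) := by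
  have hp2 : 2 < p.toReal := by
    simpa using (ENNReal.toReal_lt_toReal (by norm_num) hpt).2 hp
  have hconj := Real.HolderConjugate.conjExponent (show 1 < p.toReal by linarith)
  set q := ENNReal.ofReal (p.toReal.conjExponent) with hq
  have hqr : q.toReal = p.toReal.conjExponent := ENNReal.toReal_ofReal hconj.symm.nonneg
  rw [← hqr] at hconj
  have : Fact (1 ≤ q) := ⟨by
    rw [hq, ← ENNReal.ofReal_one]
    exact ENNReal.ofReal_le_ofReal (hqr ▸ hconj.symm.lt.le)⟩
  have hq2 : q < 2 := by
    have h1 := hconj.inv_add_inv_eq_one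
    have h2 : p.toReal⁻¹ < 2⁻¹ := inv_strictAnti₀ two_pos hp2
    have h3 : q.toReal < 2 := (inv_lt_inv₀ two_pos hconj.symm.pos).1 (by linarith)
    rw [hqr] at h3
    rw [hq, ← ENNReal.ofReal_ofNat 2]
    exact (ENNReal.ofReal_lt_ofReal_iff two_pos).2 h3
  obtain ⟨T, hT⟩ := exists_isometry_dual_lp (J := J) hconj
  have hTiso : Isometry T := AddMonoidHomClass.isometry_of_norm T hT
  obtain ⟨C, hC0, hC⟩ := exists_norm_toAlgHom_le φ hφ
  have := lp.uniformConvexSpace (J := J) hp.le hpt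
  refine totallyBounded_image_closedBall_of_unitary φ x ?_
  let Φ : unitary (Unitization ℂ A) →* (lp (fun _ : J => ℂ) p →L[ℂ] lp (fun _ : J => ℂ) p) :=
    ((NonUnitalAlgHom.toAlgHom φ : Unitization ℂ A →ₐ[ℂ] _) : Unitization ℂ A →* _).comp
      (unitary (Unitization ℂ A)).subtype
  refine totallyBounded_orbit_of_dual Φ (C := C) (fun u => ?_) (fun y => ?_) x
  · refine (hC u).trans (mul_le_of_le_one_right hC0 ?_)
    exact CStarRing.norm_of_mem_unitary u.2 |>.le
  · obtain ⟨C', hC'⟩ := hφ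
    -- Followed by the isometry `T` into `ℓ^q` with `q < 2`, this map is compact by the first case.
    -- Its extension to the unitization contains the dual orbit of `y`.
    let S : A →ₗ[ℂ] StrongDual ℂ (lp (fun _ : J => ℂ) p) :=
      { toFun := fun a => y.comp (φ a)
        map_add' := fun a b => by rw [map_add, ContinuousLinearMap.comp_add]
        map_smul' := fun c a => by rw [map_smul, ContinuousLinearMap.comp_smul]; rfl }
    have hS : TotallyBounded (S '' Metric.closedBall 0 1) := by
      rw [← totallyBounded_image_iff hTiso.isUniformInducing, ← image_comp]
      refine totallyBounded_image_closedBall_of_lt_two hq2 (T ∘ₗ S) (M := ‖y‖ * C') fun a => ?_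
      rw [LinearMap.comp_apply, hT, mul_assoc]
      exact (ContinuousLinearMap.opNorm_comp_le _ _).trans
        (mul_le_mul_of_nonneg_left (hC' a) (norm_nonneg _))
    refine (TotallyBounded.image_unitization S y hS).subset ?_
    rintro _ ⟨u, rfl⟩
    refine ⟨u, ?_, ?_⟩
    · rw [mem_closedBall_zero_iff]
      exact CStarRing.norm_of_mem_unitary u.2 |>.le
    · ext z
      simp [Φ, S, Algebra.algebraMap_eq_smul_one]

/-- The orbits of the unit ball of a C⋆-algebra under a bounded homomorphism into the operators on
`ℓᵖ` are totally bounded, for `1 ≤ p < ∞` and `p ≠ 2`. -/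
theorem totallyBounded_image_closedBall (hpt : p ≠ ⊤) (hp2 : p ≠ 2)
    (φ : A →ₙₐ[ℂ] (lp (fun _ : J => ℂ) p →L[ℂ] lp (fun _ : J => ℂ) p))
    (hφ : ∃ C : ℝ, ∀ a, ‖φ a‖ ≤ C * ‖a‖) (x : lp (fun _ : J => ℂ) p) :
    TotallyBounded ((fun a => φ a x) '' Metric.closedBall 0 1) := by
  rcases hp2.lt_or_gt with hp | hp
  · obtain ⟨C, hC⟩ := hφ
    refine totallyBounded_image_closedBall_of_lt_two hp
      ((ContinuousLinearMap.apply ℂ (lp (fun _ : J => ℂ) p) x).toLinearMap.comp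
        (φ : A →ₗ[ℂ] (lp (fun _ : J => ℂ) p →L[ℂ] lp (fun _ : J => ℂ) p)))
      (M := C * ‖x‖) fun a => ?_
    refine ((φ a).le_opNorm x).trans ?_
    rw [mul_right_comm]
    exact mul_le_mul_of_nonneg_right (hC a) (norm_nonneg _)
  · exact totallyBounded_image_closedBall_of_two_lt hp hpt φ hφ x

end Homomorphism

theorem theorem1 {p : ENNReal} [Fact (1 ≤ p)] (hp_one : 1 < p) (hp_top : p < ⊤) (hp_two : p ≠ 2)
    {J : Type*} {A : Type*} [NonUnitalCStarAlgebra A]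
    (φ : A →ₙₐ[ℂ] (lp (fun _ : J => ℂ) p →L[ℂ] lp (fun _ : J => ℂ) p))
    (hφ : ∃ C : ℝ, ∀ a : A, ‖φ a‖ ≤ C * ‖a‖) :
    (∀ x : lp (fun _ : J => ℂ) p,
      IsCompact (closure {y : lp (fun _ : J => ℂ) p | ∃ a : A, ‖a‖ ≤ 1 ∧ φ a x = y})) ∧
    (∃ S : NonUnitalCStarAlgebra (KernelQuotient φ),
      IsQuotientCStarStructure φ S ∧ @IsResiduallyFiniteDimensional (KernelQuotient φ) S) := by
  have htb := totallyBounded_image_closedBall hp_top.ne hp_two φ hφ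
  refine ⟨fun x => isCompact_iff_totallyBounded_isComplete.2
    ⟨((htb x).subset ?_).closure, isClosed_closure.isComplete⟩,
    exists_isResiduallyFiniteDimensional_kernelQuotient φ fun a ha =>
      exists_finiteDimensional_rep_of_totallyBounded_orbits φ hφ htb ha⟩
  rintro y ⟨a, ha, rfl⟩
  exact ⟨a, mem_closedBall_zero_iff.2 ha, rfl⟩
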